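/- Let $K$ be an algebraically closed field of characteristic different from $2$, and let $r,n\ge 1$ be integers. Let $\mathcal{Q}_{r,n}$ be the quiver with vertices $x^j_i$, $\tau(x^j_i)$ ($1\le j\le r$, $1\le i\le n$) and $u=\tau(u)$, and, writing $x^j_{n+1}=u$, with arrows $a^j_i\colon x^j_i\to x^j_{i+1}$ and $\tau(a^j_i)\colon \tau(x^j_{i+1})\to\tau(x^j_i)$. Let $I$ be the two-sided ideal of the path algebra $K\mathcal{Q}_{r,n}$ generated by the elements $\tau(a^j_n)a^j_n$, $1\le j\le r$. Let $\beta^\delta(x^j_i)=\beta^\delta(\tau(x^j_i))=i$ and $\beta^\delta(u)=2n+\delta$. Fix a nondegenerate bilinear form on $V(u)=K^{2n+\delta}$, symmetric with $\delta\in\{0,1\}$ (orthogonal case, $\mathcal{Q}^+_{r,n}$) or skew-symmetric with $\delta=0$ (symplectic case, $\mathcal{Q}^-_{r,n}$, where $\beta=\beta^0$), and let $V(x^j_i)=K^i$ and $V(\tau(x^j_i))=V(x^j_i)^*$. The symmetric representation variety $\mathrm{SRep}(\mathcal{Q}^\pm_{r,n},\beta^\delta)$, with its Zariski topology, consists of the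 representations $V$ of $\mathcal{Q}_{r,n}$ on these spaces that are annihilated by $I$ and for which the map of $\tau(a^j_i)$ is the adjoint of the map of $a^j_i$, that is, $V_{\tau(a^j_i)}=V_{a^j_i}^*$ for $i<n$ and $V_{\tau(a^j_n)}=V_{a^j_n}^*J$, where $J\colon V(u)\to V(u)^*$ is the isomorphism given by the form. An irreducible component of it is called faithful if every element of $K\mathcal{Q}_{r,n}$ that annihilates all representations in the component lies in $I$. Then $\mathrm{SRep}(\mathcal{Q}^+_{r,n},\beta^1)$ and $\mathrm{SRep}(\mathcal{Q}^-_{r,n},\beta)$ are irreducible, and $\mathrm{SRep}(\mathcal{Q}^+_{r,n},\beta^0)$ has exactly $2^r$ irreducible components. All irreducible components of these varieties are faithful; in the even orthogonal case $\mathrm{SRep}(\mathcal{Q}^+_{r,n},\beta^0)$ the faithfulness is asserted when $n\ge 2$ or $r=1$. -/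

import Mathlib

/-! ## Path algebras and representations of quivers -/

namespace FlagQuiver

section PathAlgebra

variable (K : Type*) (V : Type*) [CommRing K] [Quiver V]

/-- All paths of a quiver, with arbitrary source and target. -/
abbrev TotalPath : Type _ := Σ x y : V, Quiver.Path x y

/-- All arrows of a quiver, with arbitrary tail and head. -/
abbrev TotalArrow : Type _ := Σ x y : V, (x ⟶ y)

/-- The path algebra: finite linear combinations of paths. -/
def PathAlgebra : Type _ := TotalPath V →₀ K

namespace PathAlgebra

noncomputable instance : AddCommGroup (PathAlgebra K V) :=
  inferInstanceAs (AddCommGroup (TotalPath V →₀ K))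

noncomputable instance : Module K (PathAlgebra K V) :=
  inferInstanceAs (Module K (TotalPath V →₀ K))

/-- The path algebra as the space of finitely supported functions on paths. -/
noncomputable def toFinsupp : PathAlgebra K V ≃ₗ[K] (TotalPath V →₀ K) :=
  LinearEquiv.refl K (TotalPath V →₀ K)

variable {V}

/-- A path, as a basis element of the path algebra. -/
noncomputable def ofPath {x y : V} (p : Quiver.Path x y) : PathAlgebra K V :=
  (toFinsupp K V).symm (Finsupp.single ⟨x, y, p⟩ 1)

/-- The linear map with prescribed values on the paths. -/
noncomputable def lift {M : Type*} [AddCommGroup M] [Module K M] (F : TotalPath V → M) :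
    PathAlgebra K V →ₗ[K] M :=
  Finsupp.linearCombination K F ∘ₗ (toFinsupp K V).toLinearMap

theorem lift_ofPath {M : Type*} [AddCommGroup M] [Module K M] (F : TotalPath V → M) {x y : V}
    (p : Quiver.Path x y) : lift K F (ofPath K p) = F ⟨x, y, p⟩ := by
  simp [lift, ofPath]

open Classical in
/-- The product `p q` of two paths: first `q`, then `p` if `q` ends where `p` starts, and `0`
otherwise. -/
noncomputable def mulPath (p q : TotalPath V) : PathAlgebra K V :=
  if h : q.2.1 = p.1 then ofPath K (q.2.2.comp (p.2.2.cast h.symm rfl)) else 0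

variable (V)

/-- The bilinear extension of the product of paths. -/
noncomputable def mulHom : PathAlgebra K V →ₗ[K] PathAlgebra K V →ₗ[K] PathAlgebra K V :=
  lift K fun p => lift K fun q => mulPath K p q

noncomputable instance : Mul (PathAlgebra K V) := ⟨fun f g => mulHom K V f g⟩

/-- The unit is the sum of the trivial paths. -/
noncomputable instance [Fintype V] : One (PathAlgebra K V) :=
  ⟨∑ x : V, ofPath K (Quiver.Path.nil : Quiver.Path x x)⟩

variable {K V}

theorem mul_def (f g : PathAlgebra K V) : f * g = mulHom K V f g := rfl

theorem one_def [Fintype V] :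
    (1 : PathAlgebra K V) = ∑ x : V, ofPath K (Quiver.Path.nil : Quiver.Path x x) := rfl

theorem induction_on {P : PathAlgebra K V → Prop} (f : PathAlgebra K V) (h0 : P 0)
    (hadd : ∀ f g, P f → P g → P (f + g))
    (hpath : ∀ (c : K) {x y : V} (p : Quiver.Path x y), P (c • ofPath K p)) : P f := by
  obtain ⟨f, rfl⟩ := (toFinsupp K V).symm.surjective f
  refine Finsupp.induction_linear f (by simpa using h0)
    (fun f g hf hg => by simpa only [map_add] using hadd _ _ hf hg) ?_
  rintro ⟨x, y, p⟩ c
  have := hpath c p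
  rwa [ofPath, ← map_smul, Finsupp.smul_single_one] at this

theorem ofPath_mul_ofPath_eq {x y z w : V} (p : Quiver.Path z w) (q : Quiver.Path x y) :
    ofPath K p * ofPath K q = mulPath K ⟨z, w, p⟩ ⟨x, y, q⟩ := by
  rw [mul_def, mulHom, lift_ofPath, lift_ofPath]

theorem ofPath_mul_ofPath {x y w : V} (p : Quiver.Path y w) (q : Quiver.Path x y) :
    ofPath K p * ofPath K q = ofPath K (q.comp p) := by
  rw [ofPath_mul_ofPath_eq]
  simp [mulPath]

theorem ofPath_mul_ofPath_of_ne {x y z w : V} (p : Quiver.Path z w) (q : Quiver.Path x y)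
    (h : y ≠ z) : ofPath K p * ofPath K q = 0 := by
  rw [ofPath_mul_ofPath_eq]
  simp [mulPath, h]

theorem smul_mul' (c : K) (f g : PathAlgebra K V) : (c • f) * g = c • (f * g) := by
  simp [mul_def]

theorem mul_smul' (c : K) (f g : PathAlgebra K V) : f * (c • g) = c • (f * g) := by
  simp [mul_def]

noncomputable instance : NonUnitalNonAssocRing (PathAlgebra K V) where
  left_distrib f g h := by simp [mul_def]
  right_distrib f g h := by simp [mul_def]
  zero_mul f := by simp [mul_def]
  mul_zero f := by simp [mul_def]

protected theorem mul_assoc (f g h : PathAlgebra K V) : f * g * h = f * (g * h) := by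
  refine induction_on (P := fun f => f * g * h = f * (g * h)) f (by simp)
    (fun a b ha hb => by simp only [add_mul, ha, hb]) ?_
  intro c x y p
  refine induction_on (P := fun g => (c • ofPath K p) * g * h = (c • ofPath K p) * (g * h)) g
    (by simp) (fun a b ha hb => by simp only [add_mul, mul_add, ha, hb]) ?_
  intro d z w q
  refine induction_on (P := fun h => (c • ofPath K p) * (d • ofPath K q) * h
    = (c • ofPath K p) * ((d • ofPath K q) * h)) h
    (by simp) (fun a b ha hb => by simp only [mul_add, ha, hb]) ?_
  intro e u v r
  simp only [smul_mul', mul_smul']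
  congr 3
  by_cases h1 : w = x
  · subst h1
    by_cases h2 : v = z
    · subst h2
      simp only [ofPath_mul_ofPath, Quiver.Path.comp_assoc]
    · rw [ofPath_mul_ofPath, ofPath_mul_ofPath_of_ne _ _ h2, ofPath_mul_ofPath_of_ne _ _ h2,
        mul_zero]
  · rw [ofPath_mul_ofPath_of_ne _ _ h1, zero_mul]
    by_cases h2 : v = z
    · subst h2
      rw [ofPath_mul_ofPath, ofPath_mul_ofPath_of_ne _ _ h1]
    · rw [ofPath_mul_ofPath_of_ne _ _ h2, mul_zero]

protected theorem one_mul [Fintype V] (f : PathAlgebra K V) : 1 * f = f := by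
  refine induction_on (P := fun f => 1 * f = f) f (by simp)
    (fun a b ha hb => by rw [mul_add, ha, hb]) ?_
  intro c x y p
  rw [mul_smul', one_def, Finset.sum_mul, Finset.sum_eq_single y, ofPath_mul_ofPath,
    Quiver.Path.comp_nil]
  · exact fun z _ hz => ofPath_mul_ofPath_of_ne _ _ hz.symm
  · simp

protected theorem mul_one [Fintype V] (f : PathAlgebra K V) : f * 1 = f := by
  refine induction_on (P := fun f => f * 1 = f) f (by simp)
    (fun a b ha hb => by rw [add_mul, ha, hb]) ?_
  intro c x y p
  rw [smul_mul', one_def, Finset.mul_sum, Finset.sum_eq_single x, ofPath_mul_ofPath,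
    Quiver.Path.nil_comp]
  · exact fun z _ hz => ofPath_mul_ofPath_of_ne _ _ hz
  · simp

noncomputable instance [Fintype V] : Ring (PathAlgebra K V) :=
  { (inferInstance : NonUnitalNonAssocRing (PathAlgebra K V)) with
    mul_assoc := PathAlgebra.mul_assoc
    one := 1
    one_mul := PathAlgebra.one_mul
    mul_one := PathAlgebra.mul_one }

end PathAlgebra

end PathAlgebra

section Rep

variable (K : Type*) {V : Type*} [CommRing K] [Quiver V]

/-- The representation variety of dimension vector `β`, through its `K`-points: a linear map
`K ^ β x → K ^ β y`, given by its matrix, for each arrow `x ⟶ y`. -/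
def Rep (β : V → ℕ) : Type _ :=
  ∀ ⦃x y : V⦄, (x ⟶ y) → Matrix (Fin (β y)) (Fin (β x)) K

namespace Rep

/-- The index set of the coordinates (matrix entries) on `Rep K β`. -/
abbrev CoordIndex (β : V → ℕ) : Type _ :=
  Σ a : TotalArrow V, Fin (β a.2.1) × Fin (β a.1)

variable {K} {β : V → ℕ}

/-- The coordinates of a representation. -/
def coords (R : Rep K β) : CoordIndex β → K := fun i => R i.1.2.2 i.2.1 i.2.2

/-- The Zariski topology: generated by the nonvanishing loci of polynomials in the matrix
entries. -/
instance : TopologicalSpace (Rep K β) :=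
  TopologicalSpace.generateFrom
    {U | ∃ p : MvPolynomial (CoordIndex β) K, U = {R | MvPolynomial.eval R.coords p ≠ 0}}

/-- The linear map by which a path acts. -/
def pathMap (R : Rep K β) {x : V} : ∀ {y : V}, Quiver.Path x y → Matrix (Fin (β y)) (Fin (β x)) K
  | _, .nil => 1
  | _, .cons p a => R a * R.pathMap p

open Classical in
/-- The path algebra acts on the direct sum of the spaces at the vertices; a path from `x` to `y`
acts through its linear map from the summand at `x` to the summand at `y`. -/
noncomputable def act (R : Rep K β) :
    PathAlgebra K V →ₗ[K] Module.End K (∀ x : V, Fin (β x) → K) :=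
  PathAlgebra.lift K fun p =>
    LinearMap.single K (fun x : V => Fin (β x) → K) p.2.1 ∘ₗ
      (R.pathMap p.2.2).mulVecLin ∘ₗ LinearMap.proj p.1

end Rep

/-- A set of representations is faithful with respect to the ideal `I` if every element of the
path algebra that annihilates all its members lies in `I`. -/
def IsFaithful {K : Type*} [CommRing K] {β : V → ℕ} (I : TwoSidedIdeal (PathAlgebra K V))
    (C : Set (Rep K β)) : Prop :=
  ∀ f : PathAlgebra K V, (∀ R ∈ C, R.act f = 0) → f ∈ I

end Rep

/-! ## Symmetric quivers and their symmetric representations -/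

/-- A symmetric quiver: an involution on vertices and on arrows that reverses arrows, signs on the
fixed vertices and on the fixed arrows, and a choice `pos` of one arrow in every two-element orbit
of arrows. -/
structure SymQuiver (V : Type*) [Quiver V] where
  τ : V → V
  τHom : ∀ {x y : V}, (x ⟶ y) → (τ y ⟶ τ x)
  τ_τ : ∀ x, τ (τ x) = x
  τHom_τHom : ∀ {x y : V} (a : x ⟶ y),
    (⟨τ (τ x), τ (τ y), τHom (τHom a)⟩ : TotalArrow V) = ⟨x, y, a⟩
  vertexSign : {x : V // τ x = x} → ℤˣ
  arrowSign : {a : TotalArrow V // (⟨τ a.2.1, τ a.1, τHom a.2.2⟩ : TotalArrow V) = a} → ℤˣ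
  pos : Set (TotalArrow V)
  pos_iff : ∀ a : TotalArrow V, (⟨τ a.2.1, τ a.1, τHom a.2.2⟩ : TotalArrow V) ≠ a →
    (a ∈ pos ↔ (⟨τ a.2.1, τ a.1, τHom a.2.2⟩ : TotalArrow V) ∉ pos)
  not_pos : ∀ a : TotalArrow V, (⟨τ a.2.1, τ a.1, τHom a.2.2⟩ : TotalArrow V) = a → a ∉ pos

namespace SymQuiver

variable {V : Type*} [Quiver V] (S : SymQuiver V) (K : Type*) [Field K]

/-- A dimension vector invariant under the involution, together with the Gram matrix of a
nondegenerate form at every fixed vertex, symmetric or skew-symmetric according to the sign of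
the vertex. -/
structure FormedDim where
  dim : V → ℕ
  dim_τ : ∀ x, dim (S.τ x) = dim x
  form : ∀ x : {x : V // S.τ x = x}, Matrix (Fin (dim x)) (Fin (dim x)) K
  form_transpose : ∀ x, (form x).transpose = ((S.vertexSign x : ℤ) : K) • form x
  form_isUnit_det : ∀ x, IsUnit (form x).det

variable {S K}

open Classical in
/-- The matrix of the pairing between the spaces at `τ x` and at `x`: the given form if `x` is
fixed, and otherwise the standard duality pairing, the two spaces being dual to each other. -/
noncomputable def FormedDim.pairing (β : S.FormedDim K) (x : V) :
    Matrix (Fin (β.dim (S.τ x))) (Fin (β.dim x)) K :=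
  Matrix.of fun i j =>
    if h : S.τ x = x then β.form ⟨x, h⟩ (Fin.cast (β.dim_τ x) i) j
    else if Fin.cast (β.dim_τ x) i = j then 1 else 0

/-- The symmetric representation variety, inside the representation variety of the underlying
quiver: the map of `τ a` is adjoint to that of `a` under the pairings for the chosen arrows, and
up to the sign of `a` for the fixed arrows. Here `(R (τ a))ᵀ * B x = B y * R a` says that
`⟨R (τ a) v, w⟩ = ⟨v, R a w⟩` for `v` in the space at `τ y` and `w` in the space at `x`. -/
def SRep (β : S.FormedDim K) : Set (Rep K β.dim) :=
  {R | (∀ a ∈ S.pos,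
      (R (S.τHom a.2.2)).transpose * β.pairing a.1 = β.pairing a.2.1 * R a.2.2) ∧
    ∀ a : {a : TotalArrow V // (⟨S.τ a.2.1, S.τ a.1, S.τHom a.2.2⟩ : TotalArrow V) = a},
      (R (S.τHom a.1.2.2)).transpose * β.pairing a.1.1 =
        ((S.arrowSign a : ℤ) : K) • (β.pairing a.1.2.1 * R a.1.2.2)}

/-- The symmetric representation variety of a symmetric quiver with relations: the symmetric
representations annihilated by the ideal of relations. -/
def SRepRel (β : S.FormedDim K) (I : TwoSidedIdeal (PathAlgebra K V)) : Set (Rep K β.dim) :=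
  {R | R ∈ SRep β ∧ ∀ f ∈ I, R.act f = 0}

end SymQuiver

/-! ## Flag quivers -/

/-- The vertices `x j i`, their partners `x' j i`, and the fixed vertex `u`. The index `i` starts
from `0`, so that `x j i` is the vertex usually written with index `i + 1`. -/
inductive Vertex (r n : ℕ) : Type
  | x (j : Fin r) (i : Fin n) : Vertex r n
  | u : Vertex r n
  | x' (j : Fin r) (i : Fin n) : Vertex r n
  deriving DecidableEq, Fintype

/-- The arrows of the flag quiver: along each branch into `u` (`a`, and `aLast` for the one that
ends in `u`), and their partners out of `u` (`b`, and `bLast` for the one that starts in `u`). -/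
inductive Arrow (r n : ℕ) : Vertex r n → Vertex r n → Type
  | a (j : Fin r) (i k : Fin n) (h : (k : ℕ) = i + 1) : Arrow r n (.x j i) (.x j k)
  | aLast (j : Fin r) (i : Fin n) (h : n = i + 1) : Arrow r n (.x j i) .u
  | bLast (j : Fin r) (i : Fin n) (h : n = i + 1) : Arrow r n .u (.x' j i)
  | b (j : Fin r) (i k : Fin n) (h : (k : ℕ) = i + 1) : Arrow r n (.x' j k) (.x' j i)

instance (r n : ℕ) : Quiver (Vertex r n) := ⟨Arrow r n⟩

/-- The involution on vertices. -/
def Vertex.τ {r n : ℕ} : Vertex r n → Vertex r n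
  | .x j i => .x' j i
  | .u => .u
  | .x' j i => .x j i

/-- The involution on arrows. -/
def Arrow.τ {r n : ℕ} : ∀ {v w : Vertex r n}, Arrow r n v w → Arrow r n w.τ v.τ
  | _, _, .a j i k h => .b j i k h
  | _, _, .aLast j i h => .bLast j i h
  | _, _, .bLast j i h => .aLast j i h
  | _, _, .b j i k h => .a j i k h

/-- The arrows of the branches into `u`. -/
def Arrow.IsIncoming {r n : ℕ} : ∀ {v w : Vertex r n}, Arrow r n v w → Prop
  | _, _, .a _ _ _ _ => True
  | _, _, .aLast _ _ _ => True
  | _, _, .bLast _ _ _ => False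
  | _, _, .b _ _ _ _ => False

/-- The flag quiver as a symmetric quiver; `ε = 1` is the orthogonal and `ε = -1` the symplectic
case. No arrow is fixed. -/
def flagSym (r n : ℕ) (ε : ℤˣ) : SymQuiver (Vertex r n) where
  τ := Vertex.τ
  τHom := fun a => Arrow.τ a
  τ_τ := by rintro (_ | _ | _) <;> rfl
  τHom_τHom := by rintro _ _ (_ | _ | _ | _) <;> rfl
  vertexSign := fun _ => ε
  arrowSign := fun _ => 1
  pos := {a | Arrow.IsIncoming a.2.2}
  pos_iff := by
    rintro ⟨_, _, (_ | _ | _ | _)⟩ _ <;> simp [Arrow.IsIncoming, Arrow.τ]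
  not_pos := by
    rintro ⟨_, _, (_ | _ | _ | _)⟩ h <;> simp [Vertex.τ] at h

/-- The dimension vector: `i + 1` at the vertices `x j i` and `x' j i`, and `2 n + δ` at `u`. -/
def flagDim (r n δ : ℕ) : Vertex r n → ℕ
  | .x _ i => i + 1
  | .u => 2 * n + δ
  | .x' _ i => i + 1

theorem eq_u_of_τ_eq {r n : ℕ} {v : Vertex r n} (h : v.τ = v) : v = .u := by
  cases v <;> simp [Vertex.τ] at h ⊢

/-- The dimension vector of the flag quiver with the form `J` on the space at `u`. -/
def flagFormedDim {K : Type*} [Field K] (r n δ : ℕ) (ε : ℤˣ)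
    (J : Matrix (Fin (2 * n + δ)) (Fin (2 * n + δ)) K)
    (hJ : J.transpose = ((ε : ℤ) : K) • J) (hdet : IsUnit J.det) :
    (flagSym r n ε).FormedDim K where
  dim := flagDim r n δ
  dim_τ := by rintro (_ | _ | _) <;> rfl
  form := fun v => match v with
    | ⟨.u, _⟩ => J
    | ⟨.x _ _, h⟩ => absurd h (by simp [flagSym, Vertex.τ])
    | ⟨.x' _ _, h⟩ => absurd h (by simp [flagSym, Vertex.τ])
  form_transpose := by
    rintro ⟨v, h⟩
    obtain rfl := eq_u_of_τ_eq h
    exact hJ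
  form_isUnit_det := by
    rintro ⟨v, h⟩
    obtain rfl := eq_u_of_τ_eq h
    exact hdet

/-- The relations: for each `j`, the path through `u` from the last vertex `x j i` to its partner
`x' j i` is zero. -/
noncomputable def flagRel (K : Type*) [CommRing K] (r n : ℕ) :
    TwoSidedIdeal (PathAlgebra K (Vertex r n)) :=
  TwoSidedIdeal.span
    {f | ∃ (j : Fin r) (i : Fin n) (h : n = i + 1),
      f = PathAlgebra.ofPath K
        (Quiver.Path.cons (Quiver.Path.cons Quiver.Path.nil
          (show (Vertex.x j i : Vertex r n) ⟶ .u from .aLast j i h))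
          (show (Vertex.u : Vertex r n) ⟶ .x' j i from .bLast j i h))}

/-- The symmetric representation variety of the flag quiver with relations, for the form `J` on
the space of dimension `2 n + δ` at `u`. -/
def flagSRep {K : Type*} [Field K] (r n δ : ℕ) (ε : ℤˣ)
    (J : Matrix (Fin (2 * n + δ)) (Fin (2 * n + δ)) K)
    (hJ : J.transpose = ((ε : ℤ) : K) • J) (hdet : IsUnit J.det) :
    Set (Rep K (flagDim r n δ)) :=
  SymQuiver.SRepRel (flagFormedDim r n δ ε J hJ hdet) (flagRel K r n)

/-- Every irreducible component of `X` is faithful with respect to `I`. -/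
def ComponentsFaithful {K : Type*} {V : Type*} [CommRing K] [Quiver V] {β : V → ℕ}
    (I : TwoSidedIdeal (PathAlgebra K V)) (X : Set (Rep K β)) : Prop :=
  ∀ C ∈ irreducibleComponents X, IsFaithful I ((Subtype.val : X → Rep K β) '' C)

end FlagQuiver

/-! A symmetric representation is determined by its maps along the branches. The maps below the last
vertex of a branch are free, and the relations say exactly that the last map `A` of each branch
satisfies `Aᵀ * J * A = 0`. The variety is thus an affine space times a product, over the branches,
of varieties of isotropic matrices.

Irreducibility is proved with polynomial curves: if any two points of a set are joined by a
polynomial curve inside it, two nonempty open subsets pull back to nonvanishing loci of nonzero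
one-variable polynomials, which meet because `K` is infinite (`isPreirreducible_of_curves`).
Isotropic matrices `E` and `F` are joined by `(1-t)² E + t(1-t) G + t² F` whenever `G` is orthogonal
to both and `EᵀJF + FᵀJE + GᵀJG = 0`. Column operations on `E` and `F` change `EᵀJF` by arbitrary
row and column operations. In the symplectic case a diagonal pairing works with `G = 0`. In the odd
orthogonal case the pairing can be made skew-symmetric up to one diagonal entry, and `G` absorbs
that entry through an anisotropic vector orthogonal to both images, which exists because the
dimension is odd.

In the even orthogonal case every isotropic matrix factors through a maximal isotropic subspace, and
these form two families told apart by the determinant of an orthogonal matrix carrying a reference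
frame to an adapted one. That determinant is the parity of the rank of a block
(`det_eq_neg_one_pow`). Each family is curve connected (`curveConnected_isotropicClass`), and the
nonvanishing of a minor separates the two (`exists_separating_det`). One choice of family per branch
gives `2 ^ r` components.

For faithfulness, two vertices are joined by at most one path, so an annihilating element can be
tested one path at a time. Paths from a branch to its own dual lie in the ideal; every other path
acts nontrivially on some representation with rank one last maps (`exists_pathMap_ne_zero`). Between
different branches this needs two isotropic vectors, one from each chosen family, with nonzero
pairing. In the even orthogonal case with `n = 1` each family is a single isotropic line, so two
branches in the same family pair to zero; hence the restriction. -/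

set_option linter.unusedSectionVars false

namespace FlagQuiver

/-! ## Polynomial curves -/

section Curves

open Polynomial

variable {K : Type*} [Field K]

/-- A function `K → K` given by a polynomial. -/
def IsPolyFun (f : K → K) : Prop := ∃ P : K[X], ∀ t, f t = P.eval t

theorem IsPolyFun.const (c : K) : IsPolyFun fun _ : K => c := ⟨C c, by simp⟩

theorem IsPolyFun.id : IsPolyFun fun t : K => t := ⟨X, by simp⟩

theorem IsPolyFun.add {f g : K → K} (hf : IsPolyFun f) (hg : IsPolyFun g) :
    IsPolyFun fun t => f t + g t := by
  obtain ⟨P, hP⟩ := hf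
  obtain ⟨Q, hQ⟩ := hg
  exact ⟨P + Q, by simp [hP, hQ]⟩

theorem IsPolyFun.sub {f g : K → K} (hf : IsPolyFun f) (hg : IsPolyFun g) :
    IsPolyFun fun t => f t - g t := by
  obtain ⟨P, hP⟩ := hf
  obtain ⟨Q, hQ⟩ := hg
  exact ⟨P - Q, by simp [hP, hQ]⟩

theorem IsPolyFun.mul {f g : K → K} (hf : IsPolyFun f) (hg : IsPolyFun g) :
    IsPolyFun fun t => f t * g t := by
  obtain ⟨P, hP⟩ := hf
  obtain ⟨Q, hQ⟩ := hg
  exact ⟨P * Q, by simp [hP, hQ]⟩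

theorem IsPolyFun.sum {ι : Type*} (s : Finset ι) {f : ι → K → K} (hf : ∀ i, IsPolyFun (f i)) :
    IsPolyFun fun t => ∑ i ∈ s, f i t := by
  choose P hP using hf
  exact ⟨∑ i ∈ s, P i, fun t => by simp [hP, eval_finsetSum]⟩

theorem IsPolyFun.mvPolynomial_eval {σ : Type*} {f : σ → K → K} (hf : ∀ i, IsPolyFun (f i))
    (p : MvPolynomial σ K) : IsPolyFun fun t => MvPolynomial.eval (fun i => f i t) p := by
  induction p using MvPolynomial.induction_on with
  | C a => simpa using IsPolyFun.const a
  | add p q hp hq => simpa using hp.add hq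
  | mul_X p i hp => simpa using hp.mul (hf i)

/-- Two polynomial functions that do not vanish identically have a common nonzero. -/
theorem IsPolyFun.exists_ne_zero [Infinite K] {f g : K → K} (hf : IsPolyFun f) (hg : IsPolyFun g)
    {a b : K} (ha : f a ≠ 0) (hb : g b ≠ 0) : ∃ t, f t ≠ 0 ∧ g t ≠ 0 := by
  obtain ⟨P, hP⟩ := hf
  obtain ⟨Q, hQ⟩ := hg
  have hP0 : P ≠ 0 := by rintro rfl; exact ha (by simp [hP])
  have hQ0 : Q ≠ 0 := by rintro rfl; exact hb (by simp [hQ])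
  by_contra! h
  -- Without a common nonzero the product vanishes at every point, hence is the zero polynomial
  -- because `K` is infinite.
  refine mul_ne_zero hP0 hQ0 (Polynomial.funext fun t => ?_)
  rw [eval_mul, eval_zero, ← hP, ← hQ]
  by_cases ht : f t = 0
  · rw [ht, zero_mul]
  · rw [h t ht, mul_zero]

/-- A matrix of polynomial functions. -/
def IsPolyCurve {m n : Type*} (γ : K → Matrix m n K) : Prop :=
  ∀ i j, IsPolyFun fun t => γ t i j

namespace IsPolyCurve

variable {l m n : Type*}

theorem const (A : Matrix m n K) : IsPolyCurve fun _ : K => A :=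
  fun _ _ => IsPolyFun.const _

theorem add {γ δ : K → Matrix m n K} (h : IsPolyCurve γ) (h' : IsPolyCurve δ) :
    IsPolyCurve fun t => γ t + δ t :=
  fun i j => (h i j).add (h' i j)

theorem smul {f : K → K} {γ : K → Matrix m n K} (hf : IsPolyFun f) (h : IsPolyCurve γ) :
    IsPolyCurve fun t => f t • γ t :=
  fun i j => hf.mul (h i j)

theorem mul [Fintype m] {γ : K → Matrix l m K} {δ : K → Matrix m n K} (h : IsPolyCurve γ)
    (h' : IsPolyCurve δ) : IsPolyCurve fun t => γ t * δ t :=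
  fun i j => IsPolyFun.sum _ fun k => (h i k).mul (h' k j)

theorem transpose {γ : K → Matrix m n K} (h : IsPolyCurve γ) :
    IsPolyCurve fun t => (γ t).transpose :=
  fun i j => h j i

/-- The segment between two matrices. -/
theorem segment (A B : Matrix m n K) : IsPolyCurve fun t : K => A + t • (B - A) :=
  (const A).add (smul IsPolyFun.id (const (B - A)))

end IsPolyCurve

/-- Any two members of the set of matrices are joined by a polynomial curve inside the set. -/
def CurveConnected {m n : Type*} (Y : Set (Matrix m n K)) : Prop :=
  ∀ p ∈ Y, ∀ q ∈ Y, ∃ γ : K → Matrix m n K, IsPolyCurve γ ∧ (∀ t, γ t ∈ Y) ∧ γ 0 = p ∧ γ 1 = q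

end Curves

/-! ## Irreducible sets -/

section Irreducible

variable {K V : Type*} [Field K] [Quiver V] {β : V → ℕ}

theorem Rep.isOpen_eval_ne_zero (p : MvPolynomial (Rep.CoordIndex β) K) :
    IsOpen {R : Rep K β | MvPolynomial.eval R.coords p ≠ 0} :=
  TopologicalSpace.isOpen_generateFrom_of_mem ⟨p, rfl⟩

/-- Products of polynomials make the nonvanishing loci stable under intersection, so together with
the whole space they form a basis; the whole space is the locus of the polynomial `1`. -/
theorem Rep.exists_eval_ne_zero {U : Set (Rep K β)} (hU : IsOpen U) {R : Rep K β} (hR : R ∈ U) :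
    ∃ p : MvPolynomial (Rep.CoordIndex β) K, MvPolynomial.eval R.coords p ≠ 0 ∧
      ∀ R' : Rep K β, MvPolynomial.eval R'.coords p ≠ 0 → R' ∈ U := by
  have hb := TopologicalSpace.isTopologicalBasis_of_subbasis_of_inter
    (r := {U : Set (Rep K β) | ∃ p : MvPolynomial (Rep.CoordIndex β) K,
      U = {R | MvPolynomial.eval R.coords p ≠ 0}}) rfl (by
    rintro _ ⟨p, rfl⟩ _ ⟨q, rfl⟩
    refine ⟨p * q, ?_⟩
    ext R
    simp)
  obtain ⟨W, hW, hRW, hWU⟩ := hb.exists_subset_of_mem_open hR hU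
  rcases hW with rfl | ⟨p, rfl⟩
  · exact ⟨1, by simp, fun R' _ => hWU trivial⟩
  · exact ⟨p, hRW, fun R' h => hWU h⟩

/-- A set of representations is irreducible if any two members are joined by a polynomial curve. -/
theorem isPreirreducible_of_curves [Infinite K] {S : Set (Rep K β)}
    (h : ∀ R ∈ S, ∀ R' ∈ S, ∃ γ : K → Rep K β,
      (∀ i, IsPolyFun fun t => (γ t).coords i) ∧ (∀ t, γ t ∈ S) ∧ γ 0 = R ∧ γ 1 = R') :
    IsPreirreducible S := by
  rintro U U' hU hU' ⟨R, hRS, hRU⟩ ⟨R', hRS', hRU'⟩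
  obtain ⟨γ, hγ, hS, rfl, rfl⟩ := h R hRS R' hRS'
  obtain ⟨p, hp, hpU⟩ := Rep.exists_eval_ne_zero hU hRU
  obtain ⟨q, hq, hqU⟩ := Rep.exists_eval_ne_zero hU' hRU'
  -- Along the curve `p` and `q` become one-variable polynomials, nonzero at `0` and at `1`
  -- respectively.
  obtain ⟨t, ht, ht'⟩ := IsPolyFun.exists_ne_zero (IsPolyFun.mvPolynomial_eval hγ p)
    (IsPolyFun.mvPolynomial_eval hγ q) hp hq
  exact ⟨γ t, hS t, hpU _ ht, hqU _ ht'⟩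

/-- An irredundant finite union of irreducible sets: its irreducible components are the closures
of the sets. -/
theorem irreducibleComponents_of_iUnion {α ι : Type*} [TopologicalSpace α] [Finite ι] {X : Set α}
    {C : ι → Set α} (hC : ∀ i, IsIrreducible (C i)) (hX : X = ⋃ i, C i)
    (hne : ∀ i j, i ≠ j → ¬ C i ⊆ closure (C j)) :
    irreducibleComponents X =
        Set.range (fun i => closure (Subtype.val ⁻¹' C i : Set X)) ∧
      Function.Injective (fun i => closure (Subtype.val ⁻¹' C i : Set X)) := by
  have himage : ∀ i, (Subtype.val : X → α) '' (Subtype.val ⁻¹' C i) = C i := by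
    intro i
    rw [Subtype.image_preimage_coe, Set.inter_eq_right, hX]
    exact Set.subset_iUnion C i
  have hirr : ∀ i, IsIrreducible (Subtype.val ⁻¹' C i : Set X) := by
    intro i
    refine ⟨?_, ?_⟩
    · rw [← Set.image_nonempty (f := (Subtype.val : X → α)), himage]
      exact (hC i).1
    · rintro _ _ ⟨U, hU, rfl⟩ ⟨U', hU', rfl⟩ ⟨x, hx, hxU⟩ ⟨y, hy, hyU⟩
      obtain ⟨z, hz, hzU⟩ := (hC i).2 U U' hU hU' ⟨x, hx, hxU⟩ ⟨y, hy, hyU⟩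
      exact ⟨⟨z, hX ▸ Set.mem_iUnion_of_mem i hz⟩, hz, hzU⟩
  have hsub : ∀ i j, (Subtype.val ⁻¹' C i : Set X) ⊆ closure (Subtype.val ⁻¹' C j) → i = j := by
    intro i j h
    by_contra hij
    refine hne i j hij ?_
    intro x hx
    have := h (show (⟨x, hX ▸ Set.mem_iUnion_of_mem i hx⟩ : X) ∈ _ from hx)
    rw [closure_subtype, himage] at this
    exact this
  -- An irreducible set covered by finitely many closed sets lies in one of them.
  have hcover : ∀ Z : Set X, IsIrreducible Z → ∃ j, Z ⊆ closure (Subtype.val ⁻¹' C j) := by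
    intro Z hZ
    have hsubset : (Z : Set X) ⊆ ⋃₀ ((Set.finite_range fun j =>
        closure (Subtype.val ⁻¹' C j : Set X)).toFinset : Set (Set X)) := by
      rintro ⟨x, hx⟩ _
      obtain ⟨j, hj⟩ := Set.mem_iUnion.1 (hX ▸ hx : x ∈ ⋃ i, C i)
      simp only [Set.Finite.coe_toFinset, Set.sUnion_range, Set.mem_iUnion]
      exact ⟨j, subset_closure hj⟩
    obtain ⟨W, hW, hZW⟩ := isIrreducible_iff_sUnion_isClosed.1 hZ _ (by simp) hsubset
    obtain ⟨j, rfl⟩ := (Set.Finite.mem_toFinset _).1 hW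
    exact ⟨j, hZW⟩
  refine ⟨?_, fun i j hij => hsub i j (subset_closure.trans hij.le)⟩
  ext Z
  constructor
  · rintro ⟨hZ, hZmax⟩
    obtain ⟨j, hZj⟩ := hcover Z hZ
    exact ⟨j, (hZmax (hirr j).closure hZj).antisymm hZj⟩
  · rintro ⟨i, rfl⟩
    refine ⟨(hirr i).closure, fun Z hZ hiZ => ?_⟩
    obtain ⟨j, hZj⟩ := hcover Z hZ
    obtain rfl := hsub i j (subset_closure.trans (hiZ.trans hZj))
    exact hZj

end Irreducible

/-! ## Curves of isotropic matrices -/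

section Isotropic

open Matrix

variable {K : Type*} [Field K] {ν ι : Type*} [Fintype ν] [Fintype ι] [DecidableEq ι]

/-- The matrices whose columns span a totally isotropic subspace. -/
def isotropic (ι : Type*) (J : Matrix ν ν K) : Set (Matrix ν ι K) := {A | Aᵀ * J * A = 0}

theorem isotropic_mul {κ : Type*} {J : Matrix ν ν K} {A : Matrix ν ι K} (hA : A ∈ isotropic ι J)
    (M : Matrix ι κ K) : A * M ∈ isotropic κ J := by
  have : Aᵀ * J * A = 0 := hA
  calc (A * M)ᵀ * J * (A * M) = Mᵀ * (Aᵀ * J * A) * M := by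
        simp only [transpose_mul, Matrix.mul_assoc]
    _ = 0 := by rw [this, Matrix.mul_zero, Matrix.zero_mul]

/-- The quadratic curve through `E` and `F` with middle coefficient `G`. -/
theorem exists_isotropic_curve {J : Matrix ν ν K} {E F G : Matrix ν ι K}
    (hE : Eᵀ * J * E = 0) (hF : Fᵀ * J * F = 0) (hEG : Eᵀ * J * G = 0) (hGE : Gᵀ * J * E = 0)
    (hFG : Fᵀ * J * G = 0) (hGF : Gᵀ * J * F = 0)
    (h : Eᵀ * J * F + Fᵀ * J * E + Gᵀ * J * G = 0) (M N : Matrix ι ι K) :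
    ∃ γ : K → Matrix ν ι K, IsPolyCurve γ ∧ (∀ t, γ t ∈ isotropic ι J) ∧
      γ 0 = E * M ∧ γ 1 = F * N := by
  -- The only surviving terms of the form on the first factor carry the common coefficient
  -- `t²(1-t)²`, multiplying the expression in `h`. The second factor moves the endpoints from `E`,
  -- `F` to `E * M`, `F * N` and preserves isotropy.
  refine ⟨fun t => (((1 - t) * (1 - t)) • E + ((t * (1 - t)) • G + (t * t) • F)) *
    (M + t • (N - M)), ?_, fun t => isotropic_mul ?_ _, by simp, by simp⟩
  · have h1 : IsPolyFun fun t : K => 1 - t := (IsPolyFun.const 1).sub IsPolyFun.id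
    exact ((IsPolyCurve.smul (h1.mul h1) (.const E)).add
      ((IsPolyCurve.smul (IsPolyFun.id.mul h1) (.const G)).add
        (IsPolyCurve.smul (IsPolyFun.id.mul IsPolyFun.id) (.const F)))).mul (.segment M N)
  · change _ = _
    rw [← smul_zero (t * (1 - t) * (t * (1 - t)) : K), ← h]
    simp only [transpose_add, transpose_smul, Matrix.add_mul, Matrix.mul_add, Matrix.smul_mul,
      Matrix.mul_smul, hE, hF, hEG, hGE, hFG, hGF]
    module

/-- Diagonal form of a square matrix under invertible row and column operations. -/
theorem exists_units_mul_mul_eq_diagonal (B : Matrix ι ι K) :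
    ∃ (P Q : (Matrix ι ι K)ˣ) (d : ι → K), P.val * B * Q.val = diagonal d := by
  obtain ⟨L, L', d, h⟩ := Pivot.exists_list_transvec_mul_mul_list_transvec_eq_diagonal B
  have hu : ∀ L : List (TransvectionStruct ι K),
      IsUnit (L.map TransvectionStruct.toMatrix).prod := fun L => by
    rw [Matrix.isUnit_iff_isUnit_det, TransvectionStruct.det_toMatrix_prod]
    exact isUnit_one
  exact ⟨(hu L).unit, (hu L').unit, d, h⟩

/-- If the pairing between two isotropic matrices can be brought into a form allowing a middle
coefficient, the two matrices are joined by a curve. -/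
theorem exists_isotropic_curve_of_units {J : Matrix ν ν K} {p q : Matrix ν ι K}
    (hp : p ∈ isotropic ι J) (hq : q ∈ isotropic ι J) (P Q : (Matrix ι ι K)ˣ)
    (h : ∃ G : Matrix ν ι K, pᵀ * J * G = 0 ∧ Gᵀ * J * p = 0 ∧ qᵀ * J * G = 0 ∧ Gᵀ * J * q = 0 ∧
      P.val * (pᵀ * J * q) * Q.val + Q.valᵀ * (qᵀ * J * p) * P.valᵀ + Gᵀ * J * G = 0) :
    ∃ γ : K → Matrix ν ι K, IsPolyCurve γ ∧ (∀ t, γ t ∈ isotropic ι J) ∧ γ 0 = p ∧ γ 1 = q := by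
  obtain ⟨G, h1, h2, h3, h4, h5⟩ := h
  -- The column operations put the pairing into the required form; the inverse operations, used as
  -- the end factors of the curve, restore `p` and `q`.
  have key := exists_isotropic_curve (J := J) (E := p * P.valᵀ)
    (F := q * Q.val) (G := G) (isotropic_mul hp _) (isotropic_mul hq _)
    (by rw [transpose_mul, transpose_transpose, Matrix.mul_assoc, Matrix.mul_assoc,
      ← Matrix.mul_assoc _ J, h1, Matrix.mul_zero])
    (by rw [← Matrix.mul_assoc, h2, Matrix.zero_mul])
    (by rw [transpose_mul, Matrix.mul_assoc, Matrix.mul_assoc,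
      ← Matrix.mul_assoc _ J, h3, Matrix.mul_zero])
    (by rw [← Matrix.mul_assoc, h4, Matrix.zero_mul])
    (by rw [← h5]; simp only [transpose_mul, transpose_transpose, Matrix.mul_assoc])
    P⁻¹.valᵀ Q⁻¹.val
  have e1 : p * P.valᵀ * P⁻¹.valᵀ = p := by
    rw [Matrix.mul_assoc, ← transpose_mul, Units.inv_mul, transpose_one, Matrix.mul_one]
  have e2 : q * Q.val * Q⁻¹.val = q := by
    rw [Matrix.mul_assoc, Units.mul_inv, Matrix.mul_one]
  rwa [e1, e2] at key

/-- If `EᵀJF` is a diagonal matrix `D`, skewness gives `FᵀJE = -Dᵀ = -D`, so the cross terms cancel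
and no middle coefficient is needed. -/
theorem curveConnected_isotropic_of_skew {J : Matrix ν ν K} (hJ : Jᵀ = -J) :
    CurveConnected (isotropic ι J) := by
  intro p hp q hq
  obtain ⟨P, Q, d, h⟩ := exists_units_mul_mul_eq_diagonal (pᵀ * J * q)
  refine exists_isotropic_curve_of_units hp hq P Q ⟨0, by simp, by simp, by simp, by simp, ?_⟩
  have h' := congrArg transpose h
  rw [diagonal_transpose, ← h] at h'
  simp only [transpose_mul, transpose_transpose, hJ, Matrix.neg_mul, Matrix.mul_neg,
    Matrix.mul_assoc] at h' ⊢
  rw [← h']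
  simp

/-- An even set has a fixed point free involution with alternating signs. -/
theorem exists_signed_involution (m : ℕ) (s : Finset ι) (hs : s.card = 2 * m) :
    ∃ (σ : ι → ι) (η : ι → K), (∀ i, σ (σ i) = i) ∧ (∀ i ∉ s, σ i = i) ∧
      (∀ i, η i * η i = 1) ∧ ∀ i ∈ s, η (σ i) = -η i := by
  induction m generalizing s with
  | zero =>
    obtain rfl : s = ∅ := by simpa using hs
    exact ⟨id, fun _ => 1, by simp, by simp, by simp, by simp⟩
  | succ m ih =>
    obtain ⟨a, ha⟩ : s.Nonempty := Finset.card_pos.1 (by omega)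
    have hsa : (s.erase a).card = 2 * m + 1 := by rw [Finset.card_erase_of_mem ha]; omega
    obtain ⟨b, hb⟩ : (s.erase a).Nonempty := Finset.card_pos.1 (by omega)
    have hsb : ((s.erase a).erase b).card = 2 * m := by
      rw [Finset.card_erase_of_mem hb]; omega
    obtain ⟨σ, η, h1, h2, h3, h4⟩ := ih _ hsb
    have hba : b ≠ a := Finset.ne_of_mem_erase hb
    have hσa : σ a = a := h2 a (by simp)
    have hσb : σ b = b := h2 b (by simp)
    have hna : ∀ i, i ≠ a → σ i ≠ a := fun i hi h => hi (by rw [← h1 i, h, hσa])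
    have hnb : ∀ i, i ≠ b → σ i ≠ b := fun i hi h => hi (by rw [← h1 i, h, hσb])
    -- Two elements `a`, `b` of `s` are exchanged and given opposite signs; the induction hypothesis
    -- treats the rest.
    refine ⟨fun i => if i = a then b else if i = b then a else σ i,
      fun i => if i = a then 1 else if i = b then -1 else η i, ?_, ?_, ?_, ?_⟩
    · intro i
      by_cases hia : i = a
      · simp [hia, hba]
      by_cases hib : i = b
      · simp [hib, hba]
      simp [hia, hib, hna i hia, hnb i hib, h1]
    · intro i hi
      have hia : i ≠ a := by rintro rfl; exact hi ha
      have hib : i ≠ b := by rintro rfl; exact hi (Finset.mem_of_mem_erase hb)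
      simp only [hia, hib, if_false]
      exact h2 i fun h => hi (Finset.mem_of_mem_erase (Finset.mem_of_mem_erase h))
    · intro i
      dsimp only
      split_ifs <;> simp [h3]
    · intro i hi
      by_cases hia : i = a
      · simp [hia, hba]
      by_cases hib : i = b
      · simp [hib, hba]
      simp only [hia, hib, hna i hia, hnb i hib, if_false]
      exact h4 i (by simp [hia, hib, hi])

/-- The coordinate projection onto a set of indices. -/
def indicatorMatrix (K : Type*) [Field K] (s : Finset ι) : Matrix ι ι K :=
  diagonal fun i => if i ∈ s then 1 else 0

theorem indicatorMatrix_mul_self (s : Finset ι) :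
    indicatorMatrix K s * indicatorMatrix K s = indicatorMatrix K s := by
  simp [indicatorMatrix]

theorem indicatorMatrix_transpose (s : Finset ι) :
    (indicatorMatrix K s)ᵀ = indicatorMatrix K s := by
  simp [indicatorMatrix]

/-- A matrix that restricts to an orthogonal matrix on the coordinates in `s` and vanishes on the
others; it is skew-symmetric if `s` is even, and skew-symmetric up to one diagonal entry if `s` is
odd. -/
theorem exists_almost_skew (s : Finset ι) :
    ∃ T : Matrix ι ι K, T * Tᵀ = indicatorMatrix K s ∧ indicatorMatrix K s * T = T ∧
      T * indicatorMatrix K s = T ∧ (Even s.card → Tᵀ = -T) ∧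
      (¬ Even s.card → ∃ i, T + Tᵀ = (2 : K) • Matrix.single i i 1) := by
  -- `T` will be the signed permutation matrix of `σ` on `s`. For odd `s` one index `i₀` stays fixed
  -- with sign `1`, and it alone contributes `2` to `T + Tᵀ`.
  obtain ⟨σ, η, h1, h2, h3, h4, h5⟩ : ∃ (σ : ι → ι) (η : ι → K), (∀ i, σ (σ i) = i) ∧
      (∀ i ∉ s, σ i = i) ∧ (∀ i, η i * η i = 1) ∧ (Even s.card → ∀ i ∈ s, η (σ i) = -η i) ∧
      (¬ Even s.card → ∃ i₀ ∈ s, σ i₀ = i₀ ∧ η i₀ = 1 ∧ ∀ i ∈ s, i ≠ i₀ → η (σ i) = -η i) := by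
    by_cases hs : Even s.card
    · obtain ⟨m, hm⟩ := hs
      obtain ⟨σ, η, h1, h2, h3, h4⟩ := exists_signed_involution (K := K) m s (by omega)
      exact ⟨σ, η, h1, h2, h3, fun _ => h4, fun h => absurd ⟨m, hm⟩ h⟩
    · obtain ⟨m, hm⟩ := Nat.not_even_iff_odd.1 hs
      obtain ⟨a, ha⟩ : s.Nonempty := Finset.card_pos.1 (by omega)
      obtain ⟨σ, η, h1, h2, h3, h4⟩ := exists_signed_involution (K := K) m (s.erase a)
        (by rw [Finset.card_erase_of_mem ha]; omega)
      have hσa : σ a = a := h2 a (by simp)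
      have hna : ∀ i, i ≠ a → σ i ≠ a := fun i hi h => hi (by rw [← h1 i, h, hσa])
      refine ⟨σ, fun i => if i = a then 1 else η i, h1,
        fun i hi => h2 i fun h => hi (Finset.mem_of_mem_erase h), fun i => ?_,
        fun h => absurd h hs, fun _ => ⟨a, ha, hσa, by simp, fun i hi hia => ?_⟩⟩
      · dsimp only
        split_ifs <;> simp [h3]
      · simp only [hia, hna i hia, if_false]
        exact h4 i (by simp [hia, hi])
  have hσs : ∀ i, σ i ∈ s ↔ i ∈ s := by
    have : ∀ i, i ∈ s → σ i ∈ s := fun i hi => by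
      by_contra h
      have h' := h2 _ h
      rw [h1] at h'
      exact h (h' ▸ hi)
    exact fun i => ⟨fun h => h1 i ▸ this _ h, this i⟩
  have hinj : ∀ i k, σ i = σ k ↔ i = k := fun i k =>
    ⟨fun h => by rw [← h1 i, h, h1], fun h => by rw [h]⟩
  have hσ : ∀ i k, i = σ k ↔ k = σ i := fun i k =>
    ⟨fun h => by rw [h, h1], fun h => by rw [h, h1]⟩
  refine ⟨Matrix.of fun i j => if j = σ i then (if i ∈ s then η i else 0) else 0,
    ?_, ?_, ?_, ?_, ?_⟩
  · ext i k
    simp only [Matrix.mul_apply, transpose_apply, of_apply, ite_mul, zero_mul,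
      Finset.sum_ite_eq', Finset.mem_univ, if_true, hinj, indicatorMatrix, diagonal_apply]
    by_cases hik : i = k
    · subst hik
      by_cases hi : i ∈ s <;> simp [hi, h3]
    · simp [hik]
  · ext i k
    by_cases hi : i ∈ s <;> simp [indicatorMatrix, hi]
  · ext i k
    by_cases hk : k = σ i
    · by_cases hi : i ∈ s <;> simp [indicatorMatrix, hi, hk, hσs]
    · simp [indicatorMatrix, hk]
  · intro hs
    ext i k
    by_cases hk : k = σ i
    · have hi : i = σ k := (hσ i k).2 hk
      by_cases his : i ∈ s
      · have := h4 hs i his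
        simp [hk, h1, hσs, his, this]
      · simp [hk, h1, hσs, his]
    · have hi : i ≠ σ k := fun h => hk ((hσ i k).1 h)
      simp [hk, hi]
  · intro hs
    obtain ⟨a, ha, hσa, hηa, hη⟩ := h5 hs
    refine ⟨a, ?_⟩
    ext i k
    by_cases hk : k = σ i
    · have hi : i = σ k := (hσ i k).2 hk
      by_cases hia : i = a
      · subst hia
        rw [hσa] at hk
        subst hk
        simp [hσa, hηa, ha]
        norm_num
      · by_cases his : i ∈ s
        · have := hη i his hia
          simp [hk, h1, hσs, his, this, Ne.symm hia]
        · simp [hk, h1, hσs, his, Ne.symm hia]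
    · have hi : i ≠ σ k := fun h => hk ((hσ i k).1 h)
      have : ¬ (a = i ∧ a = k) := by
        rintro ⟨rfl, rfl⟩
        exact hk hσa.symm
      simp [hk, hi, this]

/-- The support of a vector. -/
noncomputable def suppFinset (d : ι → K) : Finset ι := by
  classical exact Finset.univ.filter fun i => d i ≠ 0

theorem mem_suppFinset {d : ι → K} {i : ι} : i ∈ suppFinset d ↔ d i ≠ 0 := by
  simp [suppFinset]

/-- The inverse `d⁻¹` is entrywise with `0⁻¹ = 0`, so `diagonal d⁻¹` is a pseudo-inverse of
`diagonal d`. -/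
theorem diagonal_mul_diagonal_inv (d : ι → K) :
    diagonal d * diagonal d⁻¹ = indicatorMatrix K (suppFinset d) := by
  rw [diagonal_mul_diagonal, indicatorMatrix]
  congr 1
  ext i
  by_cases hi : d i = 0 <;> simp [mem_suppFinset, hi]

theorem diagonal_inv_mul_diagonal (d : ι → K) :
    diagonal d⁻¹ * diagonal d = indicatorMatrix K (suppFinset d) := by
  rw [← diagonal_mul_diagonal_inv, diagonal_mul_diagonal, diagonal_mul_diagonal]
  simp [mul_comm]

theorem diagonal_mul_indicatorMatrix (d : ι → K) :
    diagonal d * indicatorMatrix K (suppFinset d) = diagonal d := by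
  rw [indicatorMatrix, diagonal_mul_diagonal]
  congr 1
  ext i
  by_cases hi : d i = 0 <;> simp [mem_suppFinset, hi]

theorem indicatorMatrix_mul_diagonal (d : ι → K) :
    indicatorMatrix K (suppFinset d) * diagonal d = diagonal d := by
  rw [indicatorMatrix, diagonal_mul_diagonal]
  congr 1
  ext i
  by_cases hi : d i = 0 <;> simp [mem_suppFinset, hi]

/-- Row and column operations bring a square matrix into a form that is skew-symmetric up to one
diagonal entry. -/
theorem exists_units_mul_mul_almost_skew (B : Matrix ι ι K) :
    ∃ P Q : (Matrix ι ι K)ˣ, P.val * B * Q.val + (P.val * B * Q.val)ᵀ = 0 ∨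
      ∃ i, P.val * B * Q.val + (P.val * B * Q.val)ᵀ = (2 : K) • Matrix.single i i 1 := by
  obtain ⟨P, Q, d, h⟩ := exists_units_mul_mul_eq_diagonal B
  obtain ⟨T, hT, hpT, hTp, heven, hodd⟩ := exists_almost_skew (K := K) (suppFinset d)
  set p := indicatorMatrix K (suppFinset d) with hp
  have hpp : p * p = p := indicatorMatrix_mul_self _
  have hTtp : p * Tᵀ = Tᵀ := by
    have := congrArg transpose hTp
    rwa [transpose_mul, indicatorMatrix_transpose] at this
  -- The first factor is an invertible column operation turning `diagonal d` into `T`: on the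
  -- support it is `diagonal d⁻¹ * T`, elsewhere the identity.
  have hW : (diagonal d⁻¹ * T + (1 - p)) * (Tᵀ * diagonal d + (1 - p)) = 1 := by
    have e1 : diagonal d⁻¹ * T * (Tᵀ * diagonal d) = p := by
      rw [Matrix.mul_assoc, ← Matrix.mul_assoc T, hT, indicatorMatrix_mul_diagonal,
        diagonal_inv_mul_diagonal]
    have e2 : diagonal d⁻¹ * T * (1 - p) = 0 := by
      rw [Matrix.mul_sub, Matrix.mul_one, Matrix.mul_assoc, hTp, sub_self]
    have e3 : (1 - p) * (Tᵀ * diagonal d) = 0 := by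
      rw [Matrix.sub_mul, Matrix.one_mul, ← Matrix.mul_assoc, hTtp, sub_self]
    have e4 : (1 - p) * (1 - p) = 1 - p := by
      simp [Matrix.sub_mul, Matrix.mul_sub, hpp]
    rw [Matrix.add_mul, Matrix.mul_add, Matrix.mul_add, e1, e2, e3, e4]
    simp
  let W : (Matrix ι ι K)ˣ := ⟨_, _, hW, mul_eq_one_comm.1 hW⟩
  have hPBQ : P.val * B * (Q * W).val = T := by
    rw [Units.val_mul, ← Matrix.mul_assoc, h]
    change diagonal d * (diagonal d⁻¹ * T + (1 - p)) = T
    rw [Matrix.mul_add, ← Matrix.mul_assoc, diagonal_mul_diagonal_inv, hpT, Matrix.mul_sub,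
      Matrix.mul_one, diagonal_mul_indicatorMatrix, sub_self, add_zero]
  refine ⟨P, Q * W, ?_⟩
  rw [hPBQ]
  by_cases hs : Even (suppFinset d).card
  · left
    rw [heven hs, add_neg_cancel]
  · exact Or.inr (hodd hs)

end Isotropic

/-! ## Totally isotropic subspaces -/

section Subspaces

open LinearMap (BilinForm)
open Module (finrank)

variable {K V : Type*} [Field K] [AddCommGroup V] [Module K V] [FiniteDimensional K V]
  {B : BilinForm K V}

theorem two_mul_finrank_le_of_le_orthogonal (hB : B.Nondegenerate) {W : Submodule K V}
    (hW : W ≤ B.orthogonal W) : 2 * finrank K W ≤ finrank K V := by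
  have h1 := Submodule.finrank_mono hW
  rw [BilinForm.finrank_orthogonal hB] at h1
  have h2 := Submodule.finrank_le W
  omega

theorem sup_le_orthogonal_sup (hs : B.IsSymm) {W W' : Submodule K V} (hW : W ≤ B.orthogonal W)
    (hW' : W' ≤ B.orthogonal W') (h : W' ≤ B.orthogonal W) : W ⊔ W' ≤ B.orthogonal (W ⊔ W') := by
  intro x hx y hy
  obtain ⟨a, ha, b, hb, rfl⟩ := Submodule.mem_sup.1 hx
  obtain ⟨c, hc, d, hd, rfl⟩ := Submodule.mem_sup.1 hy
  have e1 : B c a = 0 := hW ha c hc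
  have e2 : B d b = 0 := hW' hb d hd
  have e3 : B c b = 0 := h hb c hc
  have e4 : B d a = 0 := by rw [hs.eq]; exact h hd a ha
  simp [e1, e2, e3, e4]

/-- Polarization, with division by `2`. -/
theorem le_orthogonal_self_of_forall (h2 : (2 : K) ≠ 0) (hs : B.IsSymm) {W : Submodule K V}
    (hW : ∀ w ∈ W, B w w = 0) : W ≤ B.orthogonal W := by
  intro x hx y hy
  have h := hW (y + x) (W.add_mem hy hx)
  simp only [map_add, LinearMap.add_apply, hW x hx, hW y hy, hs.eq x y] at h
  have h' : 2 * B y x = 0 := by linear_combination h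
  exact (mul_eq_zero.1 h').resolve_left h2

/-- In odd dimension, two totally isotropic subspaces have a common orthogonal anisotropic
vector. -/
theorem exists_orthogonal_anisotropic (h2 : (2 : K) ≠ 0) (hB : B.Nondegenerate) (hs : B.IsSymm)
    (hodd : Odd (finrank K V)) {P Q : Submodule K V} (hP : P ≤ B.orthogonal P)
    (hQ : Q ≤ B.orthogonal Q) : ∃ w ∈ B.orthogonal (P ⊔ Q), B w w ≠ 0 := by
  -- Otherwise `U = (P + Q)ᗮ` is totally isotropic, hence so are `P + U` and `Q + U`, each of
  -- dimension at most `(d - 1) / 2` for `d` odd. But their dimensions sum to at least `dim (P + Q)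
  -- + dim U = d`.
  by_contra! h
  have hU := le_orthogonal_self_of_forall h2 hs h
  set U := B.orthogonal (P ⊔ Q) with hUdef
  have hP' := two_mul_finrank_le_of_le_orthogonal hB
    (sup_le_orthogonal_sup hs hP hU (BilinForm.orthogonal_le le_sup_left))
  have hQ' := two_mul_finrank_le_of_le_orthogonal hB
    (sup_le_orthogonal_sup hs hQ hU (BilinForm.orthogonal_le le_sup_right))
  have h3 := Submodule.finrank_sup_add_finrank_inf_eq (P ⊔ U) (Q ⊔ U)
  have h4 : finrank K U ≤ finrank K ↥((P ⊔ U) ⊓ (Q ⊔ U)) :=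
    Submodule.finrank_mono (le_inf le_sup_right le_sup_right)
  have h5 : finrank K ↥(P ⊔ Q) ≤ finrank K ↥((P ⊔ U) ⊔ (Q ⊔ U)) :=
    Submodule.finrank_mono (sup_le_sup le_sup_left le_sup_left)
  have h6 := BilinForm.finrank_orthogonal hB (P ⊔ Q)
  have h7 := Submodule.finrank_le (P ⊔ Q)
  rw [← hUdef] at h6
  obtain ⟨k, hk⟩ := hodd
  omega

variable [IsAlgClosed K]

/-- A totally isotropic subspace of small dimension has an isotropic orthogonal vector outside. -/
theorem exists_isotropic_notMem (h2 : (2 : K) ≠ 0) (hB : B.Nondegenerate) (hs : B.IsSymm)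
    {W : Submodule K V} (hdim : 2 * finrank K W + 2 ≤ finrank K V) :
    ∃ v ∈ B.orthogonal W, v ∉ W ∧ B v v = 0 := by
  have hW := BilinForm.finrank_orthogonal hB W
  -- The orthogonal of `W` has dimension at least `dim W + 2`, so it contains two vectors
  -- independent modulo `W`; the line `v₁ + t v₂` then meets the quadric, by solving a quadratic
  -- equation in `t`.
  obtain ⟨v₁, hv₁, hv₁W⟩ : ∃ v ∈ B.orthogonal W, v ∉ W := by
    by_contra! h
    have := Submodule.finrank_mono (show B.orthogonal W ≤ W from h)
    omega
  obtain ⟨v₂, hv₂, hv₂W⟩ : ∃ v ∈ B.orthogonal W, v ∉ W ⊔ Submodule.span K {v₁} := by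
    by_contra! h
    have h3 := Submodule.finrank_mono (show B.orthogonal W ≤ W ⊔ Submodule.span K {v₁} from h)
    have h4 := Submodule.finrank_add_le_finrank_add_finrank W (Submodule.span K {v₁})
    have h5 := finrank_span_le_card (R := K) ({v₁} : Set V)
    simp only [Set.toFinset_singleton, Finset.card_singleton] at h5
    omega
  by_cases h0 : B v₂ v₂ = 0
  · exact ⟨v₂, hv₂, fun h => hv₂W (Submodule.mem_sup_left h), h0⟩
  have : NeZero (2 : K) := ⟨h2⟩
  obtain ⟨t, ht⟩ := exists_quadratic_eq_zero (b := 2 * B v₁ v₂) (c := B v₁ v₁) h0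
    (IsAlgClosed.exists_eq_mul_self _)
  refine ⟨v₁ + t • v₂, Submodule.add_mem _ hv₁ (Submodule.smul_mem _ _ hv₂), fun hv => ?_, ?_⟩
  · rcases eq_or_ne t 0 with rfl | ht0
    · exact hv₁W (by simpa using hv)
    · refine hv₂W ?_
      have : v₂ = t⁻¹ • ((v₁ + t • v₂) - v₁) := by simp [smul_smul, ht0]
      rw [this]
      exact Submodule.smul_mem _ _ (Submodule.sub_mem _ (Submodule.mem_sup_left hv)
        (Submodule.mem_sup_right (Submodule.mem_span_singleton_self v₁)))
  · simp only [map_add, LinearMap.add_apply, map_smul, LinearMap.smul_apply, smul_eq_mul,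
      hs.eq v₂ v₁]
    linear_combination ht

/-- In dimension `2 n`, a totally isotropic subspace lies in one of dimension `n`. -/
theorem exists_le_orthogonal_finrank_eq (h2 : (2 : K) ≠ 0) (hB : B.Nondegenerate) (hs : B.IsSymm)
    {n : ℕ} (hn : finrank K V = 2 * n) {W : Submodule K V} (hW : W ≤ B.orthogonal W) :
    ∃ L, W ≤ L ∧ L ≤ B.orthogonal L ∧ finrank K L = n := by
  have hle := two_mul_finrank_le_of_le_orthogonal hB hW
  obtain ⟨m, hm⟩ : ∃ m, finrank K W + m = n := ⟨n - finrank K W, by omega⟩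
  induction m generalizing W with
  | zero => exact ⟨W, le_rfl, hW, by omega⟩
  | succ m ih =>
    obtain ⟨v, hv, hvW, hvv⟩ := exists_isotropic_notMem h2 hB hs (W := W) (by omega)
    have hv' : Submodule.span K {v} ≤ B.orthogonal (Submodule.span K {v}) := by
      refine le_orthogonal_self_of_forall h2 hs fun w hw => ?_
      obtain ⟨c, rfl⟩ := Submodule.mem_span_singleton.1 hw
      simp [hvv]
    have hnew := sup_le_orthogonal_sup hs hW hv'
      ((Submodule.span_singleton_le_iff_mem _ _).2 hv)
    have hlt : finrank K W < finrank K ↥(W ⊔ Submodule.span K {v}) := by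
      refine Submodule.finrank_lt_finrank_of_lt (lt_of_le_of_ne le_sup_left fun h => hvW ?_)
      rw [h]
      exact Submodule.mem_sup_right (Submodule.mem_span_singleton_self v)
    have h4 := Submodule.finrank_add_le_finrank_add_finrank W (Submodule.span K {v})
    have h5 := finrank_span_le_card (R := K) ({v} : Set V)
    simp only [Set.toFinset_singleton, Finset.card_singleton] at h5
    obtain ⟨L, hL, hL', hL''⟩ := ih hnew (two_mul_finrank_le_of_le_orthogonal hB hnew) (by omega)
    exact ⟨L, le_sup_left.trans hL, hL', hL''⟩

end Subspaces

/-! ## Orthogonal forms on matrices -/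

section Orthogonal

open Matrix Module

variable {K : Type*} [Field K] {ν ι : Type*} [Fintype ν] [DecidableEq ν] [Fintype ι]
  [DecidableEq ι] {J : Matrix ν ν K}

theorem toBilin'_nondegenerate (hdet : IsUnit J.det) : J.toBilin'.Nondegenerate :=
  LinearMap.BilinForm.nondegenerate_toBilin'_of_det_ne_zero' J hdet.ne_zero

theorem toBilin'_isSymm (hJ : Jᵀ = J) : J.toBilin'.IsSymm := by
  refine ⟨fun x y => ?_⟩
  rw [Matrix.toBilin'_apply', Matrix.toBilin'_apply', dotProduct_mulVec,
    dotProduct_comm, ← mulVec_transpose, hJ]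

theorem transpose_mul_mul_apply {κ : Type*} (A : Matrix ν κ K) (C : Matrix ν ι K) (i : κ) (j : ι) :
    (Aᵀ * J * C) i j = J.toBilin' (A.col i) (C.col j) := by
  rw [Matrix.toBilin'_apply', Matrix.mul_assoc, Matrix.mul_apply]
  rfl

/-- The bridge from isotropic matrices to the dimension counts for totally isotropic subspaces. -/
theorem range_le_orthogonal_iff {A : Matrix ν ι K} :
    LinearMap.range A.mulVecLin ≤ J.toBilin'.orthogonal (LinearMap.range A.mulVecLin) ↔
      A ∈ isotropic ι J := by
  constructor
  · intro h
    ext i j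
    rw [transpose_mul_mul_apply]
    exact h ⟨Pi.single j 1, by simp⟩ _ ⟨Pi.single i 1, by simp⟩
  · rintro h _ ⟨x, rfl⟩ _ ⟨y, rfl⟩
    have h' : Aᵀ * J * A = 0 := h
    change J.toBilin' _ _ = 0
    rw [Matrix.toBilin'_apply', mulVecLin_apply, mulVecLin_apply, mulVec_mulVec,
      dotProduct_comm, dotProduct_mulVec, ← mulVec_transpose, mulVec_mulVec, ← Matrix.mul_assoc,
      h', zero_mulVec, zero_dotProduct]

/-- After row and column operations the cross terms sum to `0` or to `2` at one diagonal place. In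
the latter case the middle coefficient `G` has one nonzero column, a multiple of an anisotropic
vector orthogonal to both images. -/
theorem curveConnected_isotropic_of_odd [IsAlgClosed K] (h2 : (2 : K) ≠ 0) (hJ : Jᵀ = J)
    (hdet : IsUnit J.det) (hodd : Odd (Fintype.card ν)) : CurveConnected (isotropic ι J) := by
  intro p hp q hq
  obtain ⟨P, Q, h⟩ := exists_units_mul_mul_almost_skew (pᵀ * J * q)
  have hT : (P.val * (pᵀ * J * q) * Q.val)ᵀ = Q.valᵀ * (qᵀ * J * p) * P.valᵀ := by
    simp only [transpose_mul, transpose_transpose, hJ, Matrix.mul_assoc]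
  refine exists_isotropic_curve_of_units hp hq P Q ?_
  rw [← hT]
  rcases h with h | ⟨i, h⟩
  · exact ⟨0, by simp, by simp, by simp, by simp, by rw [h]; simp⟩
  obtain ⟨w, hw, hww⟩ := exists_orthogonal_anisotropic h2 (toBilin'_nondegenerate hdet)
    (toBilin'_isSymm hJ) (by simpa using hodd) (range_le_orthogonal_iff.2 hp)
    (range_le_orthogonal_iff.2 hq)
  -- The scalar is chosen so that `c • w` has norm `-2`, cancelling the diagonal entry.
  obtain ⟨c, hc⟩ := IsAlgClosed.exists_eq_mul_self (-2 / J.toBilin' w w)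
  set G : Matrix ν ι K := Matrix.of fun a j => if j = i then c * w a else 0 with hG
  have hcol : ∀ j, G.col j = if j = i then c • w else 0 := by
    intro j
    ext a
    by_cases hj : j = i <;> simp [hG, hj]
  have hwp : ∀ a, J.toBilin' (p.col a) w = 0 := fun a =>
    hw _ (Submodule.mem_sup_left ⟨Pi.single a 1, by simp⟩)
  have hwq : ∀ a, J.toBilin' (q.col a) w = 0 := fun a =>
    hw _ (Submodule.mem_sup_right ⟨Pi.single a 1, by simp⟩)
  have hpG : pᵀ * J * G = 0 := by
    ext a b
    rw [transpose_mul_mul_apply, hcol]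
    split_ifs <;> simp [hwp]
  have hqG : qᵀ * J * G = 0 := by
    ext a b
    rw [transpose_mul_mul_apply, hcol]
    split_ifs <;> simp [hwq]
  refine ⟨G, hpG, ?_, hqG, ?_, ?_⟩
  · simpa [Matrix.mul_assoc, hJ] using congrArg transpose hpG
  · simpa [Matrix.mul_assoc, hJ] using congrArg transpose hqG
  · rw [h]
    ext a b
    rw [Matrix.add_apply, transpose_mul_mul_apply, hcol, hcol]
    by_cases ha : a = i
    · by_cases hb : b = i
      · subst ha hb
        simp only [if_true, map_smul, LinearMap.smul_apply, smul_eq_mul, ← mul_assoc, ← hc]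
        simp [hww]
      · simp [hb, Ne.symm hb]
    · simp [ha, Ne.symm ha]

/-- In even dimension, an isotropic matrix factors through a maximal isotropic one, which is part of
a hyperbolic frame. -/
theorem exists_hyperbolic_factorization [IsAlgClosed K] (h2 : (2 : K) ≠ 0) (hJ : Jᵀ = J)
    (hdet : IsUnit J.det) (hcard : Fintype.card ν = 2 * Fintype.card ι) {A : Matrix ν ι K}
    (hA : A ∈ isotropic ι J) :
    ∃ (E F : Matrix ν ι K) (M : Matrix ι ι K), Eᵀ * J * E = 0 ∧ Eᵀ * J * F = 1 ∧
      Fᵀ * J * E = 1 ∧ Fᵀ * J * F = 0 ∧ A = E * M := by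
  obtain ⟨L, hAL, hL, hLn⟩ := exists_le_orthogonal_finrank_eq h2 (toBilin'_nondegenerate hdet)
    (toBilin'_isSymm hJ) (by simpa using hcard) (range_le_orthogonal_iff.2 hA)
  let b : Basis ι K L := (finBasisOfFinrankEq K L hLn).reindex (Fintype.equivFin ι).symm
  set E : Matrix ν ι K := Matrix.of fun v i => (b i : ν → K) v with hEdef
  have hcol : ∀ i, E.col i = b i := fun i => rfl
  have hE : Eᵀ * J * E = 0 := by
    ext i j
    rw [transpose_mul_mul_apply, hcol, hcol]
    exact hL (b j).2 _ (b i).2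
  have hEv : ∀ x, E *ᵥ x = ((∑ i, x i • b i : L) : ν → K) := by
    intro x
    ext v
    simp [hEdef, mulVec, dotProduct, mul_comm]
  have hinj : LinearMap.ker E.mulVecLin = ⊥ := by
    rw [LinearMap.ker_eq_bot']
    intro x hx
    rw [mulVecLin_apply, hEv, Submodule.coe_eq_zero] at hx
    exact funext (Fintype.linearIndependent_iff.1 b.linearIndependent x hx)
  obtain ⟨g, hg⟩ := LinearMap.exists_leftInverse_of_injective _ hinj
  have hE' : LinearMap.toMatrix' g * E = 1 := by
    rw [← LinearMap.toMatrix'_id, ← hg, LinearMap.toMatrix'_comp, ← Matrix.toLin'_apply',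
      LinearMap.toMatrix'_toLin']
  -- A left inverse of `E` gives, through `J⁻¹`, vectors dual to the columns of `E`. Subtracting
  -- half of `E * S`, where `S` is their Gram matrix, makes them isotropic and keeps the duality
  -- because `E` is isotropic.
  obtain ⟨F₀, hEF₀⟩ : ∃ F₀ : Matrix ν ι K, Eᵀ * J * F₀ = 1 := by
    refine ⟨J⁻¹ * (LinearMap.toMatrix' g)ᵀ, ?_⟩
    rw [Matrix.mul_assoc, ← Matrix.mul_assoc J, Matrix.mul_nonsing_inv _ hdet,
      Matrix.one_mul, ← transpose_mul, hE', transpose_one]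
  have hF₀E : F₀ᵀ * J * E = 1 := by
    simpa [Matrix.mul_assoc, hJ] using congrArg transpose hEF₀
  set S := F₀ᵀ * J * F₀ with hS
  have hSt : Sᵀ = S := by simp [hS, Matrix.mul_assoc, hJ]
  have hEF : Eᵀ * J * (F₀ - (2⁻¹ : K) • (E * S)) = 1 := by
    rw [Matrix.mul_sub, hEF₀, Matrix.mul_smul, ← Matrix.mul_assoc, hE]
    simp
  refine ⟨E, F₀ - (2⁻¹ : K) • (E * S), Matrix.of fun i j => b.repr ⟨A.col j, hAL
    ⟨Pi.single j 1, by simp⟩⟩ i, hE, hEF, ?_, ?_, ?_⟩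
  · simpa [Matrix.mul_assoc, hJ] using congrArg transpose hEF
  · rw [transpose_sub, transpose_smul, transpose_mul, hSt, Matrix.sub_mul, Matrix.sub_mul,
      Matrix.smul_mul, Matrix.smul_mul, Matrix.mul_assoc S, Matrix.mul_assoc S, hEF,
      Matrix.mul_sub, ← hS, Matrix.mul_smul, ← Matrix.mul_assoc, hF₀E, Matrix.one_mul,
      Matrix.mul_one, sub_sub, ← add_smul, ← two_mul, mul_inv_cancel₀ h2, one_smul, sub_self]
  · ext v j
    have h := congrArg (fun x : L => (x : ν → K) v) (b.sum_repr ⟨A.col j, hAL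
      ⟨Pi.single j 1, by simp⟩⟩)
    rw [Matrix.mul_apply]
    simp only [AddSubmonoidClass.coe_finsetSum, Finset.sum_apply, SetLike.val_smul,
      Pi.smul_apply, smul_eq_mul] at h
    rw [← show A.col j v = A v j from rfl, ← h]
    exact Finset.sum_congr rfl fun i _ => mul_comm _ _

end Orthogonal

/-! ## The split orthogonal group and the two families of maximal isotropic subspaces -/

section Split

open Matrix

variable {K : Type*} [Field K] {ν ι : Type*} [Fintype ν] [DecidableEq ν] [Fintype ι]
  [DecidableEq ι]

variable (K ι) in
/-- The Gram matrix of a hyperbolic frame. -/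
def hyp : Matrix (ι ⊕ ι) (ι ⊕ ι) K := fromBlocks 0 1 1 0

theorem hyp_mul_hyp : hyp K ι * hyp K ι = 1 := by
  simp [hyp, fromBlocks_multiply]

variable (K ι) in
/-- The split orthogonal group. -/
def splitO : Set (Matrix (ι ⊕ ι) (ι ⊕ ι) K) := {g | gᵀ * hyp K ι * g = hyp K ι}

theorem splitO_mul {g h : Matrix (ι ⊕ ι) (ι ⊕ ι) K} (hg : g ∈ splitO K ι) (hh : h ∈ splitO K ι) :
    g * h ∈ splitO K ι := by
  change gᵀ * hyp K ι * g = hyp K ι at hg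
  change hᵀ * hyp K ι * h = hyp K ι at hh
  calc (g * h)ᵀ * hyp K ι * (g * h) = hᵀ * (gᵀ * hyp K ι * g) * h := by
        simp only [transpose_mul, Matrix.mul_assoc]
    _ = hyp K ι := by rw [hg, hh]

theorem fromBlocks_mem_splitO_iff {a b c d : Matrix ι ι K} :
    fromBlocks a b c d ∈ splitO K ι ↔
      aᵀ * c + cᵀ * a = 0 ∧ aᵀ * d + cᵀ * b = 1 ∧ bᵀ * c + dᵀ * a = 1 ∧ bᵀ * d + dᵀ * b = 0 := by
  change _ = _ ↔ _
  rw [hyp, fromBlocks_transpose, fromBlocks_multiply, fromBlocks_multiply]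
  simp only [Matrix.mul_zero, Matrix.mul_one, add_zero, zero_add, fromBlocks_inj]
  constructor
  · rintro ⟨h1, h2, h3, h4⟩
    exact ⟨by rw [add_comm, h1], by rw [add_comm, h2], by rw [add_comm, h3], by rw [add_comm, h4]⟩
  · rintro ⟨h1, h2, h3, h4⟩
    exact ⟨by rw [add_comm, h1], by rw [add_comm, h2], by rw [add_comm, h3], by rw [add_comm, h4]⟩

/-- The inverse of an element of the split orthogonal group. -/
def splitInv (g : Matrix (ι ⊕ ι) (ι ⊕ ι) K) : Matrix (ι ⊕ ι) (ι ⊕ ι) K := hyp K ι * gᵀ * hyp K ι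

theorem splitInv_mul {g : Matrix (ι ⊕ ι) (ι ⊕ ι) K} (hg : g ∈ splitO K ι) : splitInv g * g = 1 := by
  change gᵀ * hyp K ι * g = hyp K ι at hg
  rw [splitInv, Matrix.mul_assoc, Matrix.mul_assoc, ← Matrix.mul_assoc gᵀ, hg, hyp_mul_hyp]

theorem mul_splitInv {g : Matrix (ι ⊕ ι) (ι ⊕ ι) K} (hg : g ∈ splitO K ι) : g * splitInv g = 1 :=
  mul_eq_one_comm.1 (splitInv_mul hg)

theorem splitInv_mem {g : Matrix (ι ⊕ ι) (ι ⊕ ι) K} (hg : g ∈ splitO K ι) :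
    splitInv g ∈ splitO K ι := by
  have h1 := mul_splitInv hg
  change gᵀ * hyp K ι * g = hyp K ι at hg
  change (splitInv g)ᵀ * hyp K ι * splitInv g = hyp K ι
  calc (splitInv g)ᵀ * hyp K ι * splitInv g
      = (g * splitInv g)ᵀ * hyp K ι * (g * splitInv g) := by
        conv_lhs => rw [← hg]
        simp only [transpose_mul, Matrix.mul_assoc]
    _ = hyp K ι := by rw [h1]; simp

theorem det_mul_det_of_mem_splitO {g : Matrix (ι ⊕ ι) (ι ⊕ ι) K} (hg : g ∈ splitO K ι) :
    g.det * g.det = 1 := by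
  have h := congrArg det (show gᵀ * hyp K ι * g = hyp K ι from hg)
  have h0 := congrArg det (hyp_mul_hyp (K := K) (ι := ι))
  rw [det_mul, det_one] at h0
  rw [det_mul, det_mul, det_transpose] at h
  linear_combination (det (hyp K ι)) * h + (1 - g.det * g.det) * h0

theorem det_eq_of_mem_splitO {g : Matrix (ι ⊕ ι) (ι ⊕ ι) K} (hg : g ∈ splitO K ι) :
    g.det = 1 ∨ g.det = -1 := mul_self_eq_one_iff.1 (det_mul_det_of_mem_splitO hg)

theorem det_splitInv {g : Matrix (ι ⊕ ι) (ι ⊕ ι) K} (hg : g ∈ splitO K ι) :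
    (splitInv g).det = g.det := by
  have h := congrArg det (splitInv_mul hg)
  rw [det_mul, det_one] at h
  linear_combination g.det * h - (splitInv g).det * det_mul_det_of_mem_splitO hg

/-- An orthogonal matrix with invertible upper left block has determinant one. -/
theorem det_eq_one_of_isUnit {a b c d : Matrix ι ι K} (hg : fromBlocks a b c d ∈ splitO K ι)
    (ha : IsUnit a) : (fromBlocks a b c d).det = 1 := by
  obtain ⟨h1, h2, -, -⟩ := fromBlocks_mem_splitO_iff.1 hg
  have := ha.invertible
  -- Schur complement: since `aᵀ c = -cᵀ a`, one has `aᵀ (d - c a⁻¹ b) = aᵀ d + cᵀ b = 1`.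
  rw [det_fromBlocks₁₁, ← det_transpose a, ← det_mul, Matrix.mul_sub, ← Matrix.mul_assoc,
    ← Matrix.mul_assoc, eq_neg_of_add_eq_zero_left h1, Matrix.neg_mul, Matrix.neg_mul,
    Matrix.mul_assoc cᵀ, mul_invOf_self, Matrix.mul_one, sub_neg_eq_add, h2, det_one]

theorem eq_zero_of_mulVec {a b c d : Matrix ι ι K} (hg : fromBlocks a b c d ∈ splitO K ι)
    {x : ι → K} (ha : a *ᵥ x = 0) (hc : c *ᵥ x = 0) : x = 0 := by
  obtain ⟨-, -, h3, -⟩ := fromBlocks_mem_splitO_iff.1 hg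
  rw [← one_mulVec x, ← h3, add_mulVec, ← mulVec_mulVec, ← mulVec_mulVec, ha, hc, mulVec_zero,
    mulVec_zero, add_zero]

/-- The element exchanging the two halves of a hyperbolic frame on the indices in `s`. -/
def swapMatrix (K : Type*) [Field K] (s : Finset ι) : Matrix (ι ⊕ ι) (ι ⊕ ι) K :=
  fromBlocks (1 - indicatorMatrix K s) (indicatorMatrix K s) (indicatorMatrix K s)
    (1 - indicatorMatrix K s)

theorem swapMatrix_mem (s : Finset ι) : swapMatrix K s ∈ splitO K ι := by
  rw [swapMatrix, fromBlocks_mem_splitO_iff]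
  simp only [transpose_sub, transpose_one, indicatorMatrix_transpose, Matrix.mul_sub,
    Matrix.sub_mul, indicatorMatrix_mul_self, Matrix.mul_one, Matrix.one_mul]
  simp

/-- The matrix is a product of one transposition for each index in `s`. The computation multiplies
by a unipotent matrix to make the upper left block `1`, and then takes the Schur complement. -/
theorem det_swapMatrix (s : Finset ι) : (swapMatrix K s).det = (-1) ^ s.card := by
  have h : swapMatrix K s * fromBlocks 1 0 1 1 =
      fromBlocks 1 (indicatorMatrix K s) 1 (1 - indicatorMatrix K s) := by
    simp [swapMatrix, fromBlocks_multiply]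
  have h' := congrArg det h
  rw [det_mul, det_fromBlocks_zero₁₂, det_one, mul_one, mul_one, det_fromBlocks_one₁₁,
    Matrix.one_mul] at h'
  rw [h', show (1 : Matrix ι ι K) - indicatorMatrix K s - indicatorMatrix K s =
    diagonal fun i => if i ∈ s then -1 else 1 by
      ext i j
      by_cases hij : i = j
      · subst hij
        by_cases hi : i ∈ s <;> simp [indicatorMatrix, hi]
      · simp [indicatorMatrix, hij], det_diagonal, Finset.prod_ite]
  simp

/-- If the lower left block is diagonal, changing the rows of the upper left block in the support
appropriately gives an invertible matrix. -/
theorem isUnit_of_diagonal {a b d : Matrix ι ι K} {e : ι → K}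
    (hg : fromBlocks a b (diagonal e) d ∈ splitO K ι) {U : Matrix ι ι K}
    (hU : indicatorMatrix K (suppFinset e) * U = U)
    (hU' : ∀ x, U *ᵥ x = 0 → diagonal e *ᵥ x = 0) :
    IsUnit ((1 - indicatorMatrix K (suppFinset e)) * a + U) := by
  obtain ⟨h1, -, -, -⟩ := fromBlocks_mem_splitO_iff.1 hg
  set p := indicatorMatrix K (suppFinset e) with hp
  have hpp : p * p = p := indicatorMatrix_mul_self _
  rw [diagonal_transpose] at h1
  rw [← mulVec_injective_iff_isUnit]
  refine LinearMap.ker_eq_bot.1 (LinearMap.ker_eq_bot'.2 fun x hx =>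
    ?_ : LinearMap.ker ((1 - p) * a + U).mulVecLin = ⊥)
  rw [mulVecLin_apply, add_mulVec] at hx
  have hUx : U *ᵥ x = 0 := by
    have := congrArg (fun y => p *ᵥ y) hx
    simpa [mulVec_add, Matrix.mul_sub, Matrix.sub_mul, ← Matrix.mul_assoc, hpp, hU] using this
  have hex := hU' x hUx
  -- The relation `aᵀ e + e a = 0` shows that `a` preserves the kernel of `diagonal e`; hence `a x =
  -- (1 - p) a x = 0`, and the first block column, being injective, forces `x = 0`.
  have hpa : p *ᵥ (a *ᵥ x) = 0 := by
    rw [hp, ← diagonal_inv_mul_diagonal, mulVec_mulVec, Matrix.mul_assoc,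
      eq_neg_of_add_eq_zero_right h1, Matrix.mul_neg, ← Matrix.mul_assoc, neg_mulVec,
      ← mulVec_mulVec, hex, mulVec_zero, neg_zero]
  refine eq_zero_of_mulVec hg ?_ hex
  rw [hUx, add_zero, ← mulVec_mulVec, sub_mulVec, hpa, sub_zero, one_mulVec] at hx
  exact hx

/-- The block diagonal element given by an invertible matrix. -/
def leviMatrix (P : (Matrix ι ι K)ˣ) : Matrix (ι ⊕ ι) (ι ⊕ ι) K :=
  fromBlocks P.val 0 0 P⁻¹.valᵀ

theorem leviMatrix_mem (P : (Matrix ι ι K)ˣ) : leviMatrix P ∈ splitO K ι := by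
  rw [leviMatrix, fromBlocks_mem_splitO_iff]
  refine ⟨by simp, ?_, ?_, by simp⟩
  · rw [← transpose_mul, Units.inv_mul]
    simp
  · rw [transpose_transpose, Units.inv_mul]
    simp

theorem det_leviMatrix (P : (Matrix ι ι K)ˣ) : (leviMatrix P).det = 1 := by
  rw [leviMatrix, det_fromBlocks_zero₁₂, det_transpose, ← det_mul, Units.mul_inv, det_one]

/-- The transpose of a unit. -/
def transposeUnit (P : (Matrix ι ι K)ˣ) : (Matrix ι ι K)ˣ :=
  ⟨P.valᵀ, P⁻¹.valᵀ, by rw [← transpose_mul, Units.inv_mul, transpose_one],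
    by rw [← transpose_mul, Units.mul_inv, transpose_one]⟩

/-- The inverse transpose on the left is what makes the lower left block change by `P * c * Q`, so
that it can be diagonalized inside the split orthogonal group without changing the determinant. -/
theorem levi_mul_fromBlocks_mul_levi (P Q : (Matrix ι ι K)ˣ) (a b c d : Matrix ι ι K) :
    leviMatrix (transposeUnit P)⁻¹ * fromBlocks a b c d * leviMatrix Q =
      fromBlocks (P⁻¹.valᵀ * a * Q.val) (P⁻¹.valᵀ * b * Q⁻¹.valᵀ) (P.val * c * Q.val)
        (P.val * d * Q⁻¹.valᵀ) := by
  rw [leviMatrix, leviMatrix, fromBlocks_multiply, fromBlocks_multiply]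
  simp [transposeUnit]

theorem levi_conj_mem (P Q : (Matrix ι ι K)ˣ) {g : Matrix (ι ⊕ ι) (ι ⊕ ι) K}
    (hg : g ∈ splitO K ι) : leviMatrix (transposeUnit P)⁻¹ * g * leviMatrix Q ∈ splitO K ι :=
  splitO_mul (splitO_mul (leviMatrix_mem _) hg) (leviMatrix_mem _)

/-- The determinant of an orthogonal matrix is the parity of the rank of its lower left block. -/
theorem det_eq_neg_one_pow {a b c d : Matrix ι ι K} (hg : fromBlocks a b c d ∈ splitO K ι)
    {P Q : (Matrix ι ι K)ˣ} {e : ι → K} (hc : P.val * c * Q.val = diagonal e) :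
    (fromBlocks a b c d).det = (-1) ^ (suppFinset e).card := by
  have hmem := levi_conj_mem P Q hg
  have hdet : (leviMatrix (transposeUnit P)⁻¹ * fromBlocks a b c d * leviMatrix Q).det =
      (fromBlocks a b c d).det := by
    rw [det_mul, det_mul, det_leviMatrix, det_leviMatrix, one_mul, mul_one]
  rw [levi_mul_fromBlocks_mul_levi, hc] at hmem hdet
  -- Swapping the two halves on the support of `e` makes the upper left block invertible, hence the
  -- determinant `1`; the swap itself accounts for the sign.
  have hu := isUnit_of_diagonal hmem (indicatorMatrix_mul_diagonal e) fun _ => id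
  have hswap := splitO_mul (swapMatrix_mem (suppFinset e)) hmem
  rw [swapMatrix, fromBlocks_multiply, indicatorMatrix_mul_diagonal] at hswap
  have h1 := det_eq_one_of_isUnit hswap hu
  have h2 : (swapMatrix K (suppFinset e) * fromBlocks (P⁻¹.valᵀ * a * Q.val)
      (P⁻¹.valᵀ * b * Q⁻¹.valᵀ) (diagonal e) (P.val * d * Q⁻¹.valᵀ)).det = 1 := by
    rw [swapMatrix, fromBlocks_multiply, indicatorMatrix_mul_diagonal]
    exact h1
  rw [det_mul, det_swapMatrix, hdet] at h2
  have h3 : ((-1 : K) ^ (suppFinset e).card) * (-1) ^ (suppFinset e).card = 1 := by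
    rw [← mul_pow]
    simp
  linear_combination (-1 : K) ^ (suppFinset e).card * h2 - (fromBlocks a b c d).det * h3

/-- An orthogonal matrix of determinant one has, after a skew-symmetric change of the complementary
isotropic subspace, an invertible upper left block. -/
theorem exists_skew_isUnit (h2 : (2 : K) ≠ 0) {a b c d : Matrix ι ι K}
    (hg : fromBlocks a b c d ∈ splitO K ι) (hdet : (fromBlocks a b c d).det = 1) :
    ∃ Z : Matrix ι ι K, Zᵀ = -Z ∧ IsUnit (a - Z * c) := by
  obtain ⟨P, Q, e, hc⟩ := exists_units_mul_mul_eq_diagonal c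
  have heven : Even (suppFinset e).card := by
    by_contra h
    rw [det_eq_neg_one_pow hg hc, (Nat.not_even_iff_odd.1 h).neg_one_pow] at hdet
    exact h2 (by linear_combination -hdet)
  have hmem := levi_conj_mem P Q hg
  rw [levi_mul_fromBlocks_mul_levi, hc] at hmem
  obtain ⟨T, hT, hpT, hTp, hskew, -⟩ := exists_almost_skew (K := K) (suppFinset e)
  have hTt := hskew heven
  set a₁ := P⁻¹.valᵀ * a * Q.val with ha₁
  obtain ⟨h1, -, -, -⟩ := fromBlocks_mem_splitO_iff.1 hmem
  rw [diagonal_transpose] at h1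
  set p := indicatorMatrix K (suppFinset e) with hp
  have hu : IsUnit ((1 - p) * a₁ + T * diagonal e) := by
    refine isUnit_of_diagonal hmem (by rw [← Matrix.mul_assoc, hpT]) fun x hx => ?_
    have : T *ᵥ ((T * diagonal e) *ᵥ x) = 0 := by rw [hx, mulVec_zero]
    have hTT : T * T = -p := by rw [← hT, hTt, Matrix.mul_neg, neg_neg]
    rwa [mulVec_mulVec, ← Matrix.mul_assoc, hTT, Matrix.neg_mul, indicatorMatrix_mul_diagonal,
      neg_mulVec, neg_eq_zero] at this
  have hDa : diagonal e * a₁ = -(a₁ᵀ * diagonal e) := eq_neg_of_add_eq_zero_right h1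
  have hZ : (p * a₁ * diagonal e⁻¹)ᵀ = -(p * a₁ * diagonal e⁻¹) := by
    rw [transpose_mul, transpose_mul, diagonal_transpose, hp, indicatorMatrix_transpose]
    conv_rhs => rw [← diagonal_inv_mul_diagonal, Matrix.mul_assoc, Matrix.mul_assoc,
      ← Matrix.mul_assoc (diagonal e), hDa]
    conv_lhs => rw [← diagonal_mul_diagonal_inv]
    simp [Matrix.mul_assoc]
  have hpap : p * a₁ * p = p * a₁ := by
    have : p * a₁ = -(diagonal e⁻¹ * (a₁ᵀ * diagonal e)) := by
      rw [hp, ← diagonal_inv_mul_diagonal, Matrix.mul_assoc, hDa, Matrix.mul_neg]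
    rw [this, Matrix.neg_mul, Matrix.mul_assoc, Matrix.mul_assoc, hp, diagonal_mul_indicatorMatrix]
  have hu' : a₁ - (p * a₁ * diagonal e⁻¹ - T) * diagonal e = (1 - p) * a₁ + T * diagonal e := by
    rw [Matrix.sub_mul, Matrix.mul_assoc _ (diagonal e⁻¹), diagonal_inv_mul_diagonal, ← hp, hpap,
      Matrix.sub_mul, Matrix.one_mul]
    abel
  refine ⟨P.valᵀ * (p * a₁ * diagonal e⁻¹ - T) * P.val, ?_, ?_⟩
  · rw [transpose_mul, transpose_mul, transpose_transpose, transpose_sub, hZ, hTt]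
    simp only [Matrix.mul_sub, Matrix.mul_neg, Matrix.neg_mul, Matrix.sub_mul, Matrix.mul_assoc]
    abel
  · rw [← hu'] at hu
    have e1 : P.valᵀ * P⁻¹.valᵀ = 1 := by rw [← transpose_mul, Units.inv_mul, transpose_one]
    have : a - P.valᵀ * (p * a₁ * diagonal e⁻¹ - T) * P.val * c =
        (transposeUnit P).val * (a₁ - (p * a₁ * diagonal e⁻¹ - T) * diagonal e) * Q⁻¹.val := by
      have e2 : (transposeUnit P).val * a₁ * Q⁻¹.val = a := by
        rw [ha₁, transposeUnit, ← Matrix.mul_assoc, ← Matrix.mul_assoc, e1, Matrix.one_mul,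
          Matrix.mul_assoc, Units.mul_inv, Matrix.mul_one]
      have e3 : diagonal e * Q⁻¹.val = P.val * c := by
        rw [← hc, Matrix.mul_assoc, Units.mul_inv, Matrix.mul_one]
      generalize p * a₁ * diagonal e⁻¹ - T = Z
      rw [Matrix.mul_sub _ a₁, Matrix.sub_mul _ _ Q⁻¹.val, e2, Matrix.mul_assoc _ _ Q⁻¹.val,
        Matrix.mul_assoc Z, e3, Matrix.mul_assoc, Matrix.mul_assoc]
      rfl
    rw [this]
    exact ((transposeUnit P).isUnit.mul hu).mul Q⁻¹.isUnit

/-- The isotropic matrices subordinate to the maximal isotropic subspaces in one of the two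
families, the family being distinguished by the determinant `ε` relative to the frame `H`. -/
def isotropicClass (H : Matrix ν (ι ⊕ ι) K) (ε : K) : Set (Matrix ν ι K) :=
  {A | ∃ g ∈ splitO K ι, ∃ M : Matrix ι ι K, g.det = ε ∧ A = H * g * fromRows M (0 : Matrix ι ι K)}

theorem unipotent_mem {X : Matrix ι ι K} (hX : Xᵀ = -X) : fromBlocks 1 0 X 1 ∈ splitO K ι := by
  rw [fromBlocks_mem_splitO_iff]
  simp [hX]

theorem unipotent_mem' {X : Matrix ι ι K} (hX : Xᵀ = -X) : fromBlocks 1 X 0 1 ∈ splitO K ι := by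
  rw [fromBlocks_mem_splitO_iff]
  simp [hX]

theorem IsPolyCurve.fromRows_zero {γ : K → Matrix ι ι K} (hγ : IsPolyCurve γ) :
    IsPolyCurve fun t => fromRows (γ t) (0 : Matrix ι ι K) := by
  rintro (i | i) j
  · exact hγ i j
  · exact IsPolyFun.const 0

/-- The quotient `g⁻¹ g'` has determinant one, so its first block column is an upper unipotent times
a lower unipotent matrix applied to `(u, 0)` with `u` invertible. The lower unipotent has skew
parameter `c u⁻¹`, which scales linearly to `0`, giving a curve inside the orthogonal group. -/
theorem curveConnected_isotropicClass (h2 : (2 : K) ≠ 0) (H : Matrix ν (ι ⊕ ι) K) (ε : K) :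
    CurveConnected (isotropicClass H ε) := by
  rintro _ ⟨g, hg, M, hε, rfl⟩ _ ⟨g', hg', M', hε', rfl⟩
  obtain ⟨a, b, c, d, hh⟩ : ∃ a b c d, splitInv g * g' = fromBlocks a b c d :=
    ⟨_, _, _, _, (fromBlocks_toBlocks _).symm⟩
  have hmem : fromBlocks a b c d ∈ splitO K ι := hh ▸ splitO_mul (splitInv_mem hg) hg'
  have hdet : (fromBlocks a b c d).det = 1 := by
    rw [← hh, det_mul, det_splitInv hg, hε, ← hε', det_mul_det_of_mem_splitO hg']
  have hg'eq : g' = g * fromBlocks a b c d := by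
    rw [← hh, ← Matrix.mul_assoc, mul_splitInv hg, Matrix.one_mul]
  obtain ⟨Z, hZ, hu⟩ := exists_skew_isUnit h2 hmem hdet
  obtain ⟨u, hu⟩ := hu
  -- This is the first block equation for `g⁻¹ g'` after multiplication by the upper unipotent with
  -- parameter `-Z`; it makes `c u⁻¹` skew.
  have hrel : u.valᵀ * c + cᵀ * u.val = 0 := by
    have := splitO_mul (unipotent_mem' (X := -Z) (by rw [transpose_neg, hZ])) hmem
    rw [fromBlocks_multiply, fromBlocks_mem_splitO_iff] at this
    have h1 := this.1
    simpa only [Matrix.one_mul, Matrix.zero_mul, zero_add, Matrix.neg_mul, ← sub_eq_add_neg, ← hu]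
      using h1
  have hX : (c * u⁻¹.val)ᵀ = -(c * u⁻¹.val) := by
    have e1 : u⁻¹.valᵀ * u.valᵀ = 1 := by rw [← transpose_mul, Units.mul_inv, transpose_one]
    calc (c * u⁻¹.val)ᵀ = u⁻¹.valᵀ * (cᵀ * u.val) * u⁻¹.val := by
          rw [transpose_mul, Matrix.mul_assoc, Matrix.mul_assoc, Units.mul_inv, Matrix.mul_one]
      _ = -(c * u⁻¹.val) := by
          rw [eq_neg_of_add_eq_zero_right hrel, Matrix.mul_neg, ← Matrix.mul_assoc, e1,
            Matrix.one_mul, Matrix.neg_mul]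
  refine ⟨fun t => H * (g * fromBlocks 1 Z 0 1) *
    (1 + t • fromBlocks 0 0 (c * u⁻¹.val) 0 : Matrix (ι ⊕ ι) (ι ⊕ ι) K) *
    fromRows (M + t • (u.val * M' - M)) (0 : Matrix ι ι K), ?_, fun t => ?_, ?_, ?_⟩
  · exact ((IsPolyCurve.const _).mul ((IsPolyCurve.const _).add
      (.smul .id (.const _)))).mul (IsPolyCurve.segment _ _).fromRows_zero
  · have ht : (1 + t • fromBlocks 0 0 (c * u⁻¹.val) 0 : Matrix (ι ⊕ ι) (ι ⊕ ι) K) =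
        fromBlocks 1 0 (t • (c * u⁻¹.val)) 1 := by
      rw [← fromBlocks_one, fromBlocks_smul, fromBlocks_add]
      simp
    refine ⟨g * fromBlocks 1 Z 0 1 * fromBlocks 1 0 (t • (c * u⁻¹.val)) 1,
      splitO_mul (splitO_mul hg (unipotent_mem' hZ))
        (unipotent_mem (by rw [transpose_smul, hX, smul_neg])), M + t • (u.val * M' - M), ?_, ?_⟩
    · simp [hε]
    · simp only [ht, Matrix.mul_assoc]
  · simp only [zero_smul, add_zero, Matrix.mul_one, ← Matrix.mul_assoc]
    rw [Matrix.mul_assoc (H * g), fromBlocks_mul_fromRows]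
    simp
  · have e1 : (1 + fromBlocks 0 0 (c * u⁻¹.val) 0 : Matrix (ι ⊕ ι) (ι ⊕ ι) K) =
        fromBlocks 1 0 (c * u⁻¹.val) 1 := by
      rw [← fromBlocks_one, fromBlocks_add]
      simp
    simp only [one_smul, add_sub_cancel]
    rw [hg'eq, e1]
    simp only [Matrix.mul_assoc, fromBlocks_mul_fromRows]
    congr 3
    · simp only [Matrix.one_mul, Matrix.mul_zero, add_zero]
      rw [← Matrix.mul_assoc u⁻¹.val, Units.inv_mul, Matrix.one_mul, hu, Matrix.sub_mul,
        Matrix.mul_assoc, sub_add_cancel]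
    · simp only [Matrix.one_mul, Matrix.mul_zero, add_zero, Matrix.zero_mul, zero_add]
      rw [← Matrix.mul_assoc u⁻¹.val, Units.inv_mul, Matrix.one_mul]

/-- A hyperbolic frame of the whole space. -/
def IsFrame (J : Matrix ν ν K) (H : Matrix ν (ι ⊕ ι) K) : Prop := Hᵀ * J * H = hyp K ι

variable {J : Matrix ν ν K}

theorem isFrame_fromCols {E F : Matrix ν ι K} (h1 : Eᵀ * J * E = 0) (h2 : Eᵀ * J * F = 1)
    (h3 : Fᵀ * J * E = 1) (h4 : Fᵀ * J * F = 0) : IsFrame J (fromCols E F) := by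
  rw [IsFrame, transpose_fromCols, fromRows_mul, fromRows_mul_fromCols, h1, h2, h3, h4, hyp]

theorem IsFrame.inv_mul {H : Matrix ν (ι ⊕ ι) K} (hH : IsFrame J H) :
    hyp K ι * Hᵀ * J * H = 1 := by
  rw [Matrix.mul_assoc, Matrix.mul_assoc, ← Matrix.mul_assoc Hᵀ, hH, hyp_mul_hyp]

theorem IsFrame.mul_inv {H : Matrix ν (ι ⊕ ι) K} (hH : IsFrame J H)
    (hcard : Fintype.card ν = 2 * Fintype.card ι) : H * (hyp K ι * Hᵀ * J) = 1 := by
  rw [Matrix.mul_eq_one_comm_of_card_eq]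
  · exact hH.inv_mul
  · rw [Fintype.card_sum, hcard, two_mul]

theorem isotropicClass_subset {H : Matrix ν (ι ⊕ ι) K} (hH : IsFrame J H) (ε : K) :
    isotropicClass H ε ⊆ isotropic ι J := by
  rintro _ ⟨g, hg, M, -, rfl⟩
  have hg' : gᵀ * hyp K ι * g = hyp K ι := hg
  have : (H * g)ᵀ * J * (H * g) = hyp K ι := by
    rw [← hg', ← show Hᵀ * J * H = hyp K ι from hH]
    simp only [transpose_mul, Matrix.mul_assoc]
  calc (H * g * fromRows M (0 : Matrix ι ι K))ᵀ * J * (H * g * fromRows M (0 : Matrix ι ι K))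
      = (fromRows M (0 : Matrix ι ι K))ᵀ * ((H * g)ᵀ * J * (H * g)) *
          fromRows M (0 : Matrix ι ι K) := by
        simp only [transpose_mul, Matrix.mul_assoc]
    _ = 0 := by
        rw [this, hyp, Matrix.mul_assoc, fromBlocks_mul_fromRows, transpose_fromRows,
          fromCols_mul_fromRows]
        simp

/-- A hyperbolic frame adapted to `A` differs from `H` by an element of the split orthogonal group,
whose determinant `1` or `-1` decides the family. -/
theorem isotropic_subset_union [IsAlgClosed K] (h2 : (2 : K) ≠ 0) (hJ : Jᵀ = J)
    (hdet : IsUnit J.det) (hcard : Fintype.card ν = 2 * Fintype.card ι)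
    {H : Matrix ν (ι ⊕ ι) K} (hH : IsFrame J H) {A : Matrix ν ι K} (hA : A ∈ isotropic ι J) :
    A ∈ isotropicClass H 1 ∨ A ∈ isotropicClass H (-1) := by
  obtain ⟨E, F, M, h1, h2, h3, h4, rfl⟩ := exists_hyperbolic_factorization h2 hJ hdet hcard hA
  have hEF := isFrame_fromCols h1 h2 h3 h4
  set g := hyp K ι * Hᵀ * J * fromCols E F with hg
  have hHg : H * g = fromCols E F := by
    rw [hg, ← Matrix.mul_assoc, hH.mul_inv hcard, Matrix.one_mul]
  have hgO : g ∈ splitO K ι := by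
    change gᵀ * hyp K ι * g = hyp K ι
    calc gᵀ * hyp K ι * g = (H * g)ᵀ * J * (H * g) := by
          rw [← show Hᵀ * J * H = hyp K ι from hH]
          simp only [transpose_mul, Matrix.mul_assoc]
      _ = hyp K ι := by rw [hHg, hEF]
  have hEM : E * M = H * g * fromRows M (0 : Matrix ι ι K) := by
    rw [hHg, fromCols_mul_fromRows, Matrix.mul_zero, add_zero]
  rcases det_eq_of_mem_splitO hgO with h | h
  · exact Or.inl ⟨g, hgO, M, h, hEM⟩
  · exact Or.inr ⟨g, hgO, M, h, hEM⟩

/-- The two families are separated by the nonvanishing of a determinant. -/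
theorem exists_separating_det (h2 : (2 : K) ≠ 0) {H : Matrix ν (ι ⊕ ι) K} (hH : IsFrame J H)
    {g : Matrix (ι ⊕ ι) (ι ⊕ ι) K} (hg : g ∈ splitO K ι) {ε : K} (hε : ε = -g.det) :
    ∃ N : Matrix ι ν K, (∀ A ∈ isotropicClass H ε, (N * A).det = 0) ∧
      ∃ A ∈ isotropicClass H g.det, (N * A).det ≠ 0 := by
  -- `N` is the first block row of the inverse of `H * g`, so it reads off the upper left block of
  -- `g⁻¹ g'`. That block is singular when `g⁻¹ g'` has determinant `-1`, by `det_eq_one_of_isUnit`.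
  have key : ∀ (g' : Matrix (ι ⊕ ι) (ι ⊕ ι) K) (M : Matrix ι ι K),
      fromCols (1 : Matrix ι ι K) (0 : Matrix ι ι K) * splitInv g * (hyp K ι * Hᵀ * J) *
        (H * g' * fromRows M (0 : Matrix ι ι K)) = (splitInv g * g').toBlocks₁₁ * M := by
    intro g' M
    rw [Matrix.mul_assoc _ (hyp K ι * Hᵀ * J), ← Matrix.mul_assoc (hyp K ι * Hᵀ * J),
      ← Matrix.mul_assoc (hyp K ι * Hᵀ * J), hH.inv_mul, Matrix.one_mul, ← Matrix.mul_assoc,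
      Matrix.mul_assoc _ (splitInv g)]
    conv_lhs => rw [← fromBlocks_toBlocks (splitInv g * g')]
    rw [Matrix.mul_assoc, fromBlocks_mul_fromRows, fromCols_mul_fromRows]
    simp
  refine ⟨fromCols (1 : Matrix ι ι K) (0 : Matrix ι ι K) * splitInv g * (hyp K ι * Hᵀ * J),
    ?_, H * g * fromRows 1 (0 : Matrix ι ι K), ⟨g, hg, 1, rfl, rfl⟩, ?_⟩
  · rintro _ ⟨g', hg', M, hdet, rfl⟩
    rw [key, det_mul]
    suffices h : (splitInv g * g').toBlocks₁₁.det = 0 by rw [h, zero_mul]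
    by_contra h
    have hmem := splitO_mul (splitInv_mem hg) hg'
    have hdet' : (splitInv g * g').det = -1 := by
      rw [det_mul, det_splitInv hg, hdet, hε, mul_neg, det_mul_det_of_mem_splitO hg]
    rw [← fromBlocks_toBlocks (splitInv g * g')] at hmem hdet'
    rw [det_eq_one_of_isUnit hmem ((Matrix.isUnit_iff_isUnit_det _).2 (isUnit_iff_ne_zero.2 h))]
      at hdet'
    exact h2 (by linear_combination hdet')
  · rw [key, splitInv_mul hg, ← fromBlocks_one, toBlocks_fromBlocks₁₁]
    simp

/-- Rank one members of the two families. -/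
theorem vecMulVec_mem_isotropicClass (H : Matrix ν (ι ⊕ ι) K) (s : Finset ι) (i k : ι) :
    vecMulVec (H.col (if i ∈ s then Sum.inr i else Sum.inl i)) (Pi.single k 1) ∈
      isotropicClass H ((-1) ^ s.card) := by
  refine ⟨swapMatrix K s, swapMatrix_mem s, Matrix.single i k 1, det_swapMatrix s, ?_⟩
  rw [swapMatrix, Matrix.mul_assoc, fromBlocks_mul_fromRows]
  ext v j
  simp only [Matrix.mul_apply, Fintype.sum_sum_type, fromRows_apply_inl, fromRows_apply_inr]
  by_cases hj : k = j
  · subst hj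
    by_cases hi : i ∈ s <;>
      simp [hi, vecMulVec_apply, indicatorMatrix, Matrix.single_apply, Matrix.sub_mul,
        diagonal_apply, mul_sub]
  · simp [vecMulVec_apply, Ne.symm hj, indicatorMatrix, hj, Matrix.sub_mul]

end Split

/-! ## The action of the path algebra -/

section Action

variable {K V : Type*} [CommRing K] [Quiver V] {β : V → ℕ}

theorem Rep.pathMap_comp (R : Rep K β) {x y z : V} (p : Quiver.Path x y) (q : Quiver.Path y z) :
    R.pathMap (p.comp q) = R.pathMap q * R.pathMap p := by
  induction q with
  | nil => simp [Rep.pathMap]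
  | cons q a ih => rw [Quiver.Path.comp_cons, Rep.pathMap, Rep.pathMap, ih, Matrix.mul_assoc]

open Classical in
theorem Rep.act_ofPath (R : Rep K β) {x y : V} (p : Quiver.Path x y) (v : ∀ x : V, Fin (β x) → K) :
    R.act (PathAlgebra.ofPath K p) v =
      Pi.single (M := fun x => Fin (β x) → K) y ((R.pathMap p).mulVec (v x)) := by
  rw [Rep.act, PathAlgebra.lift_ofPath]
  rfl

theorem Rep.act_ofPath_eq_zero (R : Rep K β) {x y : V} (p : Quiver.Path x y)
    (h : R.pathMap p = 0) : R.act (PathAlgebra.ofPath K p) = 0 := by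
  classical
  refine LinearMap.ext fun v => ?_
  rw [Rep.act_ofPath, h, Matrix.zero_mulVec, Pi.single_zero, LinearMap.zero_apply]

theorem Rep.act_mul (R : Rep K β) (f g : PathAlgebra K V) : R.act (f * g) = R.act f * R.act g := by
  classical
  refine PathAlgebra.induction_on (P := fun f => R.act (f * g) = R.act f * R.act g) f (by simp)
    (fun a b ha hb => by simp only [add_mul, map_add, ha, hb]) ?_
  intro c x y p
  refine PathAlgebra.induction_on (P := fun g => R.act ((c • PathAlgebra.ofPath K p) * g) =
    R.act (c • PathAlgebra.ofPath K p) * R.act g) g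
    (by simp) (fun a b ha hb => by simp only [mul_add, map_add, ha, hb]) ?_
  intro d z w q
  simp only [PathAlgebra.smul_mul', PathAlgebra.mul_smul', map_smul, smul_mul_assoc,
    mul_smul_comm]
  congr 2
  refine LinearMap.ext fun v => ?_
  rw [Module.End.mul_apply, Rep.act_ofPath, Rep.act_ofPath]
  by_cases h : w = x
  · subst h
    rw [PathAlgebra.ofPath_mul_ofPath, Rep.act_ofPath, Rep.pathMap_comp, Pi.single_eq_same,
      Matrix.mulVec_mulVec]
  · rw [PathAlgebra.ofPath_mul_ofPath_of_ne _ _ h, Pi.single_eq_of_ne (Ne.symm h),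
      Matrix.mulVec_zero, Pi.single_zero, map_zero, LinearMap.zero_apply]

/-- A representation is annihilated by an ideal once it is annihilated by generators. -/
theorem Rep.act_eq_zero_of_mem_span (R : Rep K β) {s : Set (PathAlgebra K V)}
    (hs : ∀ f ∈ s, R.act f = 0) {f : PathAlgebra K V} (hf : f ∈ TwoSidedIdeal.span s) :
    R.act f = 0 := by
  let φ : PathAlgebra K V →ₙ+* Module.End K (∀ x : V, Fin (β x) → K) :=
    { toFun := R.act
      map_mul' := R.act_mul
      map_zero' := map_zero _
      map_add' := map_add _ }
  have h : TwoSidedIdeal.span s ≤ TwoSidedIdeal.ker φ :=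
    TwoSidedIdeal.span_le.2 fun g hg => (TwoSidedIdeal.mem_ker φ).2 (hs g hg)
  exact (TwoSidedIdeal.mem_ker φ).1 (h hf)

open Classical in
/-- In a quiver with at most one path between any two vertices, the blocks of the action are
multiples of the maps of the paths. -/
theorem Rep.act_single_apply [∀ x y : V, Subsingleton (Quiver.Path x y)] (R : Rep K β)
    (f : PathAlgebra K V) {x y : V} (p : Quiver.Path x y) (v : Fin (β x) → K) :
    R.act f (Pi.single (M := fun x => Fin (β x) → K) x v) y =
      PathAlgebra.toFinsupp K V f ⟨x, y, p⟩ • (R.pathMap p).mulVec v := by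
  refine PathAlgebra.induction_on (P := fun f => R.act f (Pi.single x v) y =
      PathAlgebra.toFinsupp K V f ⟨x, y, p⟩ • (R.pathMap p).mulVec v) f (by simp)
    (fun a b ha hb => by simp only [map_add, LinearMap.add_apply, Pi.add_apply, ha, hb,
      Finsupp.add_apply, add_smul]) ?_
  intro c z w q
  rw [map_smul, LinearMap.smul_apply, Pi.smul_apply, Rep.act_ofPath, map_smul,
    Finsupp.smul_apply, PathAlgebra.ofPath, LinearEquiv.apply_symm_apply]
  by_cases hz : z = x
  · subst hz
    by_cases hw : w = y
    · subst hw
      obtain rfl := Subsingleton.elim p q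
      simp
    · rw [Pi.single_eq_of_ne (Ne.symm hw), Finsupp.single_eq_of_ne (by
        intro h
        exact hw (congrArg (fun t : TotalPath V => t.2.1) h).symm)]
      simp
  · rw [Pi.single_eq_of_ne hz, Finsupp.single_eq_of_ne (by
        intro h
        exact hz (congrArg (fun t : TotalPath V => t.1) h).symm)]
    simp

end Action

/-! ## Paths in the flag quiver -/

section Paths

variable {r n : ℕ}

/-- The height of a vertex, which increases by one along every arrow. -/
def Vertex.height : Vertex r n → ℕ
  | .x _ i => i
  | .u => n
  | .x' _ i => 2 * n - i

theorem Arrow.height_succ {v w : Vertex r n} (a : Arrow r n v w) : w.height = v.height + 1 := by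
  rcases a with ⟨j, i, k, h⟩ | ⟨j, i, h⟩ | ⟨j, i, h⟩ | ⟨j, i, k, h⟩ <;> simp only [Vertex.height]
  · exact h
  · exact h
  · omega
  · omega

theorem height_add_length {v w : Vertex r n} (p : Quiver.Path v w) :
    v.height + p.length = w.height := by
  induction p with
  | nil => rfl
  | cons p a ih => rw [Quiver.Path.length_cons, ← add_assoc, ih, Arrow.height_succ a]

/-- No arrow enters a branch from outside it, so the end of such a path determines the branch of its
source. -/
theorem exists_eq_of_path {v w : Vertex r n} (p : Quiver.Path v w) {j : Fin r} {i : Fin n}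
    (hw : w = .x j i) : ∃ i', v = .x j i' := by
  induction p generalizing i with
  | nil => exact ⟨i, hw⟩
  | cons p a ih =>
    subst hw
    rcases a with ⟨_, i', _, h⟩
    exact ih rfl

/-- Heights fix the length of a path, and the last arrow can be compared case by case. Only `u` can
receive several arrows, one from each branch, and there the common source determines the branch. -/
instance path_subsingleton (v w : Vertex r n) : Subsingleton (Quiver.Path v w) := by
  refine ⟨fun p => ?_⟩
  induction p with
  | nil =>
    intro q
    have h := height_add_length q
    cases q with
    | nil => rfl
    | cons q a => rw [Quiver.Path.length_cons] at h; omega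
  | cons p a ih =>
    intro q
    have h := height_add_length q
    have h' := height_add_length (p.cons a)
    rw [Quiver.Path.length_cons] at h'
    cases q with
    | nil => omega
    | cons q b =>
      rcases a with ⟨j, i, k, hk⟩ | ⟨j, i, hi⟩ | ⟨j, i, hi⟩ | ⟨j, i, k, hk⟩
      · rcases b with ⟨_, i', _, hk'⟩
        obtain rfl : i = i' := Fin.ext (by omega)
        rw [ih q]
      · rcases b with _ | ⟨j', i', hi'⟩
        obtain rfl : i = i' := Fin.ext (by omega)
        obtain ⟨_, h1⟩ := exists_eq_of_path p rfl
        obtain ⟨_, h2⟩ := exists_eq_of_path q rfl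
        obtain ⟨rfl, -⟩ : j = j' ∧ _ := by simpa using h1.symm.trans h2
        rw [ih q]
      · rcases b with _ | _ | _ | ⟨_, _, k, hk⟩
        · rw [ih q]
        · omega
      · rcases b with _ | _ | ⟨_, _, hi⟩ | ⟨_, _, k', hk'⟩
        · omega
        · obtain rfl : k = k' := Fin.ext (by omega)
          rw [ih q]

/-- A path from a branch to its dual branch lies in the ideal of relations. -/
theorem ofPath_mem_flagRel (K : Type*) [CommRing K] {v w : Vertex r n} (p : Quiver.Path v w)
    {j : Fin r} {i l : Fin n} (hv : v = .x j i) (hw : w = .x' j l) :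
    PathAlgebra.ofPath K p ∈ flagRel K r n := by
  induction p generalizing l with
  | nil => exact absurd (hv.symm.trans hw) (by simp)
  | cons p a ih =>
    subst hw
    -- Arrows of the dual branch are stripped off as left factors until the path ends with `bLast`.
    -- The arrow before that must be `aLast` of the same branch, and the remaining initial part is a
    -- right factor.
    rcases a with _ | _ | ⟨_, _, hl⟩ | ⟨_, _, k, hk⟩
    · cases p with
      | nil => exact absurd hv (by simp)
      | cons p a =>
        rcases a with _ | ⟨j', l', hl'⟩
        subst hv
        obtain ⟨_, h1⟩ := exists_eq_of_path p rfl
        obtain ⟨rfl, -⟩ : j = j' ∧ _ := by simpa using h1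
        obtain rfl : l = l' := Fin.ext (by omega)
        have hmem : PathAlgebra.ofPath K (Quiver.Path.cons (Quiver.Path.cons Quiver.Path.nil
            (show (Vertex.x j l : Vertex r n) ⟶ .u from .aLast j l hl))
            (show (Vertex.u : Vertex r n) ⟶ .x' j l from .bLast j l hl)) ∈ flagRel K r n :=
          TwoSidedIdeal.subset_span ⟨j, l, hl, rfl⟩
        have := TwoSidedIdeal.mul_mem_right (flagRel K r n) _ (PathAlgebra.ofPath K p) hmem
        rwa [PathAlgebra.ofPath_mul_ofPath] at this
    · have := TwoSidedIdeal.mul_mem_left (flagRel K r n)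
        (PathAlgebra.ofPath K (Quiver.Path.cons Quiver.Path.nil
          (show (Vertex.x' j k : Vertex r n) ⟶ .x' j l from .b j l k hk))) _ (ih rfl)
      rwa [PathAlgebra.ofPath_mul_ofPath] at this

end Paths

/-! ## The symmetric representation variety of the flag quiver -/

section SRep

open Matrix

variable {K : Type*} [Field K] {r n δ : ℕ}

/-- The representation with given maps along the branches and adjoint maps along the dual
branches. -/
def mkRep (J : Matrix (Fin (2 * n + δ)) (Fin (2 * n + δ)) K)
    (T : ∀ (_ : Fin r) (i k : Fin n), (k : ℕ) = i + 1 → Matrix (Fin (k + 1)) (Fin (i + 1)) K)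
    (A : ∀ (_ : Fin r) (i : Fin n), n = i + 1 → Matrix (Fin (2 * n + δ)) (Fin (i + 1)) K) :
    Rep K (flagDim r n δ) := fun x y a =>
  match x, y, (show Arrow r n x y from a) with
  | _, _, .a j i k h => T j i k h
  | _, _, .aLast j i h => A j i h
  | _, _, .bLast j i h => (A j i h)ᵀ * Jᵀ
  | _, _, .b j i k h => (T j i k h)ᵀ

/-- The maps along a branch. -/
def Rep.branch (R : Rep K (flagDim r n δ)) (j : Fin r) (i k : Fin n) (h : (k : ℕ) = i + 1) :
    Matrix (Fin (k + 1)) (Fin (i + 1)) K :=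
  R (show (Vertex.x j i : Vertex r n) ⟶ .x j k from .a j i k h)

/-- The last map of a branch. -/
def Rep.last (R : Rep K (flagDim r n δ)) (j : Fin r) (i : Fin n) (h : n = i + 1) :
    Matrix (Fin (2 * n + δ)) (Fin (i + 1)) K :=
  R (show (Vertex.x j i : Vertex r n) ⟶ .u from .aLast j i h)

/-- The generator acts through `Aᵀ * Jᵀ * A`, the transpose of `Aᵀ * J * A`; this turns the
relations into isotropy. -/
theorem act_flagRel_generator (J : Matrix (Fin (2 * n + δ)) (Fin (2 * n + δ)) K)
    (T : ∀ (_ : Fin r) (i k : Fin n), (k : ℕ) = i + 1 → Matrix (Fin (k + 1)) (Fin (i + 1)) K)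
    (A : ∀ (_ : Fin r) (i : Fin n), n = i + 1 → Matrix (Fin (2 * n + δ)) (Fin (i + 1)) K)
    (j : Fin r) (i : Fin n) (h : n = i + 1) :
    (mkRep J T A).act (PathAlgebra.ofPath K
        (Quiver.Path.cons (Quiver.Path.cons Quiver.Path.nil
          (show (Vertex.x j i : Vertex r n) ⟶ .u from .aLast j i h))
          (show (Vertex.u : Vertex r n) ⟶ .x' j i from .bLast j i h))) = 0 ↔
      A j i h ∈ isotropic _ J := by
  classical
  set p := (Quiver.Path.cons (Quiver.Path.cons Quiver.Path.nil
    (show (Vertex.x j i : Vertex r n) ⟶ .u from .aLast j i h))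
    (show (Vertex.u : Vertex r n) ⟶ .x' j i from .bLast j i h)) with hp
  have hmap : (mkRep J T A).pathMap p = (A j i h)ᵀ * Jᵀ * A j i h := by
    change (A j i h)ᵀ * Jᵀ * (A j i h * (1 : Matrix (Fin (i + 1)) (Fin (i + 1)) K)) = _
    rw [Matrix.mul_one]
  have hiff : A j i h ∈ isotropic _ J ↔ (A j i h)ᵀ * Jᵀ * A j i h = 0 := by
    change (A j i h)ᵀ * J * A j i h = 0 ↔ _
    rw [← transpose_eq_zero]
    simp [Matrix.mul_assoc]
  rw [hiff, ← hmap]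
  constructor
  · intro h0
    refine Matrix.ext_of_mulVec_single fun k => ?_
    have h1 := Rep.act_single_apply (mkRep J T A) (PathAlgebra.ofPath K p) p (Pi.single k 1)
    rw [h0] at h1
    rw [LinearMap.zero_apply, Pi.zero_apply] at h1
    refine Eq.trans ?_ (zero_mulVec _).symm
    rw [h1, PathAlgebra.ofPath, LinearEquiv.apply_symm_apply, Finsupp.single_eq_same, one_smul]
  · exact Rep.act_ofPath_eq_zero _ p

theorem pairing_x (J : Matrix (Fin (2 * n + δ)) (Fin (2 * n + δ)) K) (ε : ℤˣ)
    (hJ : Jᵀ = ((ε : ℤ) : K) • J) (hdet : IsUnit J.det) (j : Fin r) (i : Fin n) :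
    (flagFormedDim r n δ ε J hJ hdet).pairing (.x j i) =
      (1 : Matrix (Fin (i + 1)) (Fin (i + 1)) K) := by
  ext p q
  rw [SymQuiver.FormedDim.pairing, of_apply, dif_neg (by simp [flagSym, Vertex.τ])]
  rfl

theorem pairing_u (J : Matrix (Fin (2 * n + δ)) (Fin (2 * n + δ)) K) (ε : ℤˣ)
    (hJ : Jᵀ = ((ε : ℤ) : K) • J) (hdet : IsUnit J.det) :
    (flagFormedDim r n δ ε J hJ hdet).pairing .u = J := by
  ext p q
  rw [SymQuiver.FormedDim.pairing, of_apply, dif_pos (by simp [flagSym, Vertex.τ])]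
  rfl

theorem no_fixed_arrow (ε : ℤˣ) (a : TotalArrow (Vertex r n)) :
    (⟨(flagSym r n ε).τ a.2.1, (flagSym r n ε).τ a.1, (flagSym r n ε).τHom a.2.2⟩ :
      TotalArrow (Vertex r n)) ≠ a := by
  rcases a with ⟨x, y, a⟩
  intro h
  rcases a with _ | _ | _ | _ <;> simp [flagSym, Vertex.τ] at h

/-- The adjointness conditions, arrow by arrow. -/
theorem mem_SRep_iff {J : Matrix (Fin (2 * n + δ)) (Fin (2 * n + δ)) K} {ε : ℤˣ}
    {hJ : Jᵀ = ((ε : ℤ) : K) • J} {hdet : IsUnit J.det} {R : Rep K (flagDim r n δ)} :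
    R ∈ SymQuiver.SRep (flagFormedDim r n δ ε J hJ hdet) ↔ R = mkRep J R.branch R.last := by
  constructor
  · rintro ⟨h, -⟩
    funext x y a
    rcases a with ⟨j, i, k, hk⟩ | ⟨j, i, hi⟩ | ⟨j, i, hi⟩ | ⟨j, i, k, hk⟩
    · rfl
    · rfl
    · have := h ⟨.x j i, .u, .aLast j i hi⟩ trivial
      rw [pairing_x, pairing_u] at this
      have h' : (R (show (Vertex.u : Vertex r n) ⟶ .x' j i from .bLast j i hi))ᵀ =
        J * R.last j i hi := (Matrix.mul_one _).symm.trans this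
      rw [← transpose_inj]
      refine h'.trans ?_
      change _ = ((R.last j i hi)ᵀ * Jᵀ)ᵀ
      rw [transpose_mul, transpose_transpose, transpose_transpose]
    · have := h ⟨.x j i, .x j k, .a j i k hk⟩ trivial
      rw [pairing_x, pairing_x] at this
      have h' : (R (show (Vertex.x' j k : Vertex r n) ⟶ .x' j i from .b j i k hk))ᵀ =
        R.branch j i k hk := (Matrix.mul_one _).symm.trans (this.trans (Matrix.one_mul _))
      rw [← transpose_inj]
      refine h'.trans ?_
      change _ = ((R.branch j i k hk)ᵀ)ᵀ
      rw [transpose_transpose]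
  · intro h
    refine ⟨?_, fun a => absurd a.2 (no_fixed_arrow ε a.1)⟩
    rintro ⟨x, y, a⟩ ha
    rw [h]
    rcases a with ⟨j, i, k, hk⟩ | ⟨j, i, hi⟩ | ⟨j, i, hi⟩ | ⟨j, i, k, hk⟩
    · rw [pairing_x, pairing_x]
      change (R.branch j i k hk)ᵀᵀ * (1 : Matrix (Fin (i + 1)) (Fin (i + 1)) K) =
        (1 : Matrix (Fin (k + 1)) (Fin (k + 1)) K) * R.branch j i k hk
      rw [transpose_transpose, Matrix.mul_one, Matrix.one_mul]
    · rw [pairing_x, pairing_u]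
      change ((R.last j i hi)ᵀ * Jᵀ)ᵀ * (1 : Matrix (Fin (i + 1)) (Fin (i + 1)) K) =
        J * R.last j i hi
      rw [transpose_mul, transpose_transpose, transpose_transpose, Matrix.mul_one]
    · exact ha.elim
    · exact ha.elim

theorem mkRep_mem {J : Matrix (Fin (2 * n + δ)) (Fin (2 * n + δ)) K} {ε : ℤˣ}
    {hJ : Jᵀ = ((ε : ℤ) : K) • J} {hdet : IsUnit J.det}
    {T : ∀ (_ : Fin r) (i k : Fin n), (k : ℕ) = i + 1 → Matrix (Fin (k + 1)) (Fin (i + 1)) K}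
    {A : ∀ (_ : Fin r) (i : Fin n), n = i + 1 → Matrix (Fin (2 * n + δ)) (Fin (i + 1)) K}
    (hA : ∀ j i h, A j i h ∈ isotropic _ J) : mkRep J T A ∈ flagSRep r n δ ε J hJ hdet := by
  refine ⟨mem_SRep_iff.2 rfl, ?_⟩
  · intro f hf
    refine Rep.act_eq_zero_of_mem_span _ ?_ hf
    rintro _ ⟨j, i, h, rfl⟩
    exact (act_flagRel_generator J T A j i h).2 (hA j i h)

/-- With `mkRep_mem`, this identifies the variety with free branch maps together with isotropic last
maps. -/
theorem eq_mkRep_of_mem {J : Matrix (Fin (2 * n + δ)) (Fin (2 * n + δ)) K} {ε : ℤˣ}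
    {hJ : Jᵀ = ((ε : ℤ) : K) • J} {hdet : IsUnit J.det} {R : Rep K (flagDim r n δ)}
    (hR : R ∈ flagSRep r n δ ε J hJ hdet) :
    R = mkRep J R.branch R.last ∧ ∀ j i h, R.last j i h ∈ isotropic _ J := by
  have hEq := mem_SRep_iff.1 hR.1
  refine ⟨hEq, fun j i h => (act_flagRel_generator J R.branch R.last j i h).1 ?_⟩
  rw [← hEq]
  exact hR.2 _ (TwoSidedIdeal.subset_span ⟨j, i, h, rfl⟩)

end SRep

/-! ### Subvarieties cut out by conditions on the last maps -/

section Family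

open Matrix

variable {K : Type*} [Field K] {r n δ : ℕ}

/-- The symmetric representations whose maps into the vertex `u` lie in given sets. -/
def familySRep (J : Matrix (Fin (2 * n + δ)) (Fin (2 * n + δ)) K) (i₀ : Fin n) (h₀ : n = i₀ + 1)
    (Y : Fin r → Set (Matrix (Fin (2 * n + δ)) (Fin (i₀ + 1)) K)) : Set (Rep K (flagDim r n δ)) :=
  {R | R = mkRep J R.branch R.last ∧ ∀ j, R.last j i₀ h₀ ∈ Y j}

variable {J : Matrix (Fin (2 * n + δ)) (Fin (2 * n + δ)) K} {i₀ : Fin n} {h₀ : n = i₀ + 1}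
  {Y : Fin r → Set (Matrix (Fin (2 * n + δ)) (Fin (i₀ + 1)) K)}

theorem flagSRep_eq_familySRep {ε : ℤˣ} {hJ : Jᵀ = ((ε : ℤ) : K) • J} {hdet : IsUnit J.det} :
    flagSRep r n δ ε J hJ hdet = familySRep J i₀ h₀ fun _ => isotropic _ J := by
  ext R
  constructor
  · intro h
    obtain ⟨h1, h2⟩ := eq_mkRep_of_mem h
    exact ⟨h1, fun j => h2 j i₀ h₀⟩
  · rintro ⟨h1, h2⟩
    rw [h1]
    refine mkRep_mem fun j i h => ?_
    obtain rfl : i = i₀ := Fin.ext (by omega)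
    exact h2 j

theorem mkRep_mem_familySRep
    {T : ∀ (_ : Fin r) (i k : Fin n), (k : ℕ) = i + 1 → Matrix (Fin (k + 1)) (Fin (i + 1)) K}
    {A : ∀ (_ : Fin r) (i : Fin n), n = i + 1 → Matrix (Fin (2 * n + δ)) (Fin (i + 1)) K}
    (hA : ∀ j, A j i₀ h₀ ∈ Y j) : mkRep J T A ∈ familySRep J i₀ h₀ Y :=
  ⟨rfl, hA⟩

/-- The family of last maps determined by the maps at the last vertices. -/
def extendLast (i₀ : Fin n) (h₀ : n = i₀ + 1)
    (B : Fin r → Matrix (Fin (2 * n + δ)) (Fin (i₀ + 1)) K) (j : Fin r) (i : Fin n)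
    (h : n = i + 1) : Matrix (Fin (2 * n + δ)) (Fin (i + 1)) K :=
  (B j).submatrix id (Fin.cast (h.symm.trans h₀))

theorem extendLast_last (R : Rep K (flagDim r n δ)) :
    extendLast i₀ h₀ (fun j => R.last j i₀ h₀) = R.last := by
  funext j i h
  obtain rfl : i = i₀ := Fin.ext (by omega)
  rfl

theorem familySRep_nonempty (hY : ∀ j, (Y j).Nonempty) : (familySRep J i₀ h₀ Y).Nonempty := by
  choose B hB using hY
  exact ⟨mkRep J (fun _ _ _ _ => 0) (extendLast i₀ h₀ B), mkRep_mem_familySRep hB⟩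

/-- The conditions on different branches are independent: branch maps are joined by segments, last
maps by the given curves, and the adjoint maps depend linearly on these. -/
theorem isPreirreducible_familySRep [Infinite K] (hY : ∀ j, CurveConnected (Y j)) :
    IsPreirreducible (familySRep J i₀ h₀ Y) := by
  refine isPreirreducible_of_curves fun R hR R' hR' => ?_
  choose γ hγ hγY hγ0 hγ1 using fun j => hY j _ (hR.2 j) _ (hR'.2 j)
  refine ⟨fun t => mkRep J
    (fun j i k h => R.branch j i k h + t • (R'.branch j i k h - R.branch j i k h))
    (extendLast i₀ h₀ fun j => γ j t), ?_, fun t => mkRep_mem_familySRep fun j => hγY j t, ?_, ?_⟩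
  · have hlast : ∀ j i h, IsPolyCurve fun t => extendLast i₀ h₀ (fun j => γ j t) j i h :=
      fun j i h p q => hγ j p _
    rintro ⟨⟨x, y, a⟩, p, q⟩
    rcases a with ⟨j, i, k, hk⟩ | ⟨j, i, hi⟩ | ⟨j, i, hi⟩ | ⟨j, i, k, hk⟩
    · exact IsPolyCurve.segment (R.branch j i k hk) (R'.branch j i k hk) p q
    · exact hlast j i hi p q
    · exact ((hlast j i hi).transpose.mul (.const Jᵀ)) p q
    · exact (IsPolyCurve.segment (R.branch j i k hk) (R'.branch j i k hk)).transpose p q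
  · simp only [hγ0, zero_smul, add_zero, extendLast_last]
    exact hR.1.symm
  · simp only [hγ1, one_smul, add_sub_cancel, extendLast_last]
    exact hR'.1.symm

theorem isIrreducible_familySRep [Infinite K] (hY : ∀ j, CurveConnected (Y j))
    (hne : ∀ j, (Y j).Nonempty) : IsIrreducible (familySRep J i₀ h₀ Y) :=
  ⟨familySRep_nonempty hne, isPreirreducible_familySRep hY⟩

theorem isClosed_det_eq_zero (N : Matrix (Fin (i₀ + 1)) (Fin (2 * n + δ)) K) (j : Fin r) :
    IsClosed {R : Rep K (flagDim r n δ) | (N * R.last j i₀ h₀).det = 0} := by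
  -- The generic version of `N * R.last j i₀ h₀`, with the entries of the last map as variables.
  let D : Matrix (Fin (i₀ + 1)) (Fin (i₀ + 1))
      (MvPolynomial (Rep.CoordIndex (flagDim r n δ)) K) := Matrix.of fun p q =>
    ∑ s, MvPolynomial.C (N p s) * MvPolynomial.X ⟨⟨.x j i₀, .u, .aLast j i₀ h₀⟩, s, q⟩
  have h := Rep.isOpen_eval_ne_zero (K := K) D.det
  rw [← isOpen_compl_iff]
  convert h using 1
  ext R
  have : MvPolynomial.eval R.coords D.det =
      (N * R.last j i₀ h₀).det := by
    rw [RingHom.map_det]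
    congr 1
    ext p q
    rw [Matrix.mul_apply, RingHom.mapMatrix_apply, map_apply, show D p q = ∑ s,
      MvPolynomial.C (N p s) * MvPolynomial.X ⟨⟨.x j i₀, .u, .aLast j i₀ h₀⟩, s, q⟩ from rfl, map_sum]
    refine Finset.sum_congr rfl fun s _ => ?_
    rw [map_mul, MvPolynomial.eval_C, MvPolynomial.eval_X]
    rfl
  simp [this]

/-- Families with a separating determinant are not nested up to closure. -/
theorem not_familySRep_subset_closure
    {Y' : Fin r → Set (Matrix (Fin (2 * n + δ)) (Fin (i₀ + 1)) K)} (hne : ∀ j, (Y j).Nonempty)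
    (j : Fin r) (N : Matrix (Fin (i₀ + 1)) (Fin (2 * n + δ)) K)
    (hN : ∀ A ∈ Y' j, (N * A).det = 0) (hN' : ∃ A ∈ Y j, (N * A).det ≠ 0) :
    ¬ familySRep J i₀ h₀ Y ⊆ closure (familySRep J i₀ h₀ Y') := by
  intro h
  have h1 : closure (familySRep J i₀ h₀ Y') ⊆ {R | (N * R.last j i₀ h₀).det = 0} :=
    closure_minimal (fun R hR => hN _ (hR.2 j)) (isClosed_det_eq_zero N j)
  choose B hB using hne
  obtain ⟨A, hA, hdet⟩ := hN'
  -- The separating matrix `A` is placed on branch `j`, with arbitrary members of `Y` on the others.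
  have h2 := h1 (h (mkRep_mem_familySRep (T := fun _ _ _ _ => 0)
    (A := extendLast i₀ h₀ (Function.update B j A)) fun k => by
      change Function.update B j A k ∈ Y k
      by_cases hk : k = j
      · subst hk
        rwa [Function.update_self]
      · rw [Function.update_of_ne hk]
        exact hB k))
  refine hdet ?_
  have h3 : (N * Function.update B j A j).det = 0 := h2
  rwa [Function.update_self] at h3

end Family

/-! ## Faithfulness -/

section Faithful

open Matrix

variable {K : Type*} [Field K] {r n δ : ℕ}

/-- A representation through the first basis vectors, sending those at the last vertices to given
vectors. -/
def testRep (J : Matrix (Fin (2 * n + δ)) (Fin (2 * n + δ)) K)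
    (v : Fin r → Fin (2 * n + δ) → K) : Rep K (flagDim r n δ) :=
  mkRep J (fun _ _ _ _ => Matrix.single 0 0 1) fun j _ _ => vecMulVec (v j) (Pi.single 0 1)

/-- Vectors compatible with the maps of `testRep`. -/
def testVec (J : Matrix (Fin (2 * n + δ)) (Fin (2 * n + δ)) K)
    (v : Fin r → Fin (2 * n + δ) → K) (w : Fin (2 * n + δ) → K) :
    ∀ x : Vertex r n, Fin (flagDim r n δ x) → K
  | .x _ i => (Pi.single 0 1 : Fin (i + 1) → K)
  | .u => w
  | .x' k i => (v k ⬝ᵥ Jᵀ *ᵥ w) • (Pi.single 0 1 : Fin (i + 1) → K)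

/-- Each arrow carries the chosen vector at its tail to that at its head, except that entry into `u`
from branch `j` produces `v j` instead of `w`. Hence `hw` asks for equality only on branches
reachable from `x`. -/
theorem testRep_pathMap (J : Matrix (Fin (2 * n + δ)) (Fin (2 * n + δ)) K)
    (v : Fin r → Fin (2 * n + δ) → K) (w : Fin (2 * n + δ) → K) {x y : Vertex r n}
    (hw : ∀ j i, Quiver.Path x (.x j i) → v j = w) (p : Quiver.Path x y) :
    (testRep J v).pathMap p *ᵥ testVec J v w x = testVec J v w y := by
  induction p with
  | nil => exact one_mulVec _
  | cons p a ih =>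
    rw [Rep.pathMap, ← mulVec_mulVec, ih]
    rcases a with ⟨j, i, k, hk⟩ | ⟨j, i, hi⟩ | ⟨j, i, hi⟩ | ⟨j, i, k, hk⟩
    · change Matrix.single (0 : Fin (k + 1)) (0 : Fin (i + 1)) (1 : K) *ᵥ Pi.single 0 1 =
        Pi.single 0 1
      ext q
      simp [Matrix.single_apply, Pi.single_apply, eq_comm]
    · change vecMulVec (v j) (Pi.single (0 : Fin (i + 1)) (1 : K)) *ᵥ Pi.single 0 1 = w
      rw [← hw j i p, vecMulVec_mulVec]
      simp
    · change ((vecMulVec (v j) (Pi.single (0 : Fin (i + 1)) (1 : K)))ᵀ * Jᵀ) *ᵥ w =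
        (v j ⬝ᵥ Jᵀ *ᵥ w) • Pi.single 0 1
      rw [← mulVec_mulVec, transpose_vecMulVec, vecMulVec_mulVec]
      simp
    · change (Matrix.single (0 : Fin (k + 1)) (0 : Fin (i + 1)) (1 : K))ᵀ *ᵥ
        ((v j ⬝ᵥ Jᵀ *ᵥ w) • Pi.single 0 1) = (v j ⬝ᵥ Jᵀ *ᵥ w) • Pi.single 0 1
      rw [mulVec_smul]
      congr 1
      ext q
      simp [Matrix.single_apply, Pi.single_apply, eq_comm]

theorem single_zero_one_ne_zero (i : ℕ) : (Pi.single 0 1 : Fin (i + 1) → K) ≠ 0 :=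
  Pi.single_ne_zero_iff.2 one_ne_zero

variable {J : Matrix (Fin (2 * n + δ)) (Fin (2 * n + δ)) K} {i₀ : Fin n} {h₀ : n = i₀ + 1}
  {Y : Fin r → Set (Matrix (Fin (2 * n + δ)) (Fin (i₀ + 1)) K)}

theorem exists_dotProduct_ne_zero (hdet : IsUnit J.det) {v : Fin (2 * n + δ) → K} (hv : v ≠ 0) :
    ∃ w, v ⬝ᵥ Jᵀ *ᵥ w ≠ 0 := by
  by_contra! h
  refine hv (dotProduct_eq_zero v fun w => ?_)
  have := h (Jᵀ⁻¹ *ᵥ w)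
  rwa [mulVec_mulVec, Matrix.mul_nonsing_inv _ (by rwa [det_transpose]), one_mulVec] at this

/-- It suffices that the test vector at the end of the path is nonzero. At a dual branch this is a
nonzero pairing of `v k` with `w`. For a path starting outside the branches `w` is free and
nondegeneracy applies; for one starting in branch `j ≠ k`, `w` is `v j` and `h2` applies. -/
theorem exists_pathMap_ne_zero (hdet : IsUnit J.det)
    (h1 : ∀ j, ∃ v, v ≠ 0 ∧ vecMulVec v (Pi.single 0 1) ∈ Y j)
    (h2 : ∀ j k, j ≠ k → ∃ v w, vecMulVec v (Pi.single 0 1) ∈ Y j ∧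
      vecMulVec w (Pi.single 0 1) ∈ Y k ∧ w ⬝ᵥ Jᵀ *ᵥ v ≠ 0)
    {x y : Vertex r n} (p : Quiver.Path x y) (hp : ∀ j i l, x = .x j i → y ≠ .x' j l) :
    ∃ R ∈ familySRep J i₀ h₀ Y, R.pathMap p ≠ 0 := by
  choose v hv hvY using h1
  have key : ∀ (v : Fin r → Fin (2 * n + δ) → K) (w : Fin (2 * n + δ) → K),
      (∀ j, vecMulVec (v j) (Pi.single 0 1) ∈ Y j) →
      (∀ j i, Quiver.Path x (.x j i) → v j = w) → testVec J v w y ≠ 0 →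
      ∃ R ∈ familySRep J i₀ h₀ Y, R.pathMap p ≠ 0 := by
    intro v w hvY hw hy
    refine ⟨testRep J v, mkRep_mem_familySRep hvY, fun h => hy ?_⟩
    rw [← testRep_pathMap J v w hw p, h, zero_mulVec]
  have hx : ∀ (v : Fin r → Fin (2 * n + δ) → K) (j : Fin r), (∃ i, x = .x j i) →
      ∀ k i, Quiver.Path x (.x k i) → v k = v j := by
    rintro v j ⟨i, rfl⟩ k l q
    obtain ⟨_, hq⟩ := exists_eq_of_path q rfl
    obtain ⟨rfl, -⟩ : j = k ∧ _ := by simpa using hq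
    rfl
  have hx' : (∀ j i, x ≠ .x j i) → ∀ (w : Fin (2 * n + δ) → K) (k : Fin r) (i : Fin n),
      Quiver.Path x (.x k i) → v k = w := by
    intro h w k i q
    obtain ⟨_, hq⟩ := exists_eq_of_path q rfl
    exact absurd hq (h _ _)
  rcases y with ⟨k, l⟩ | _ | ⟨k, l⟩
  · exact key v (v k) hvY (hx v k (exists_eq_of_path p rfl)) (single_zero_one_ne_zero _)
  · rcases x with ⟨j, i⟩ | _ | ⟨j, i⟩
    · exact key v (v j) hvY (hx v j ⟨i, rfl⟩) (hv j)
    · have h0 : 0 < 2 * n + δ := by omega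
      exact key v (Pi.single ⟨0, h0⟩ 1) hvY (hx' (by simp) _)
        (Pi.single_ne_zero_iff.2 one_ne_zero)
    · have := height_add_length p
      simp only [Vertex.height] at this
      omega
  · by_cases hxx : ∃ j i, x = .x j i
    · obtain ⟨j, i, rfl⟩ := hxx
      have hjk : j ≠ k := by
        rintro rfl
        exact hp j i l rfl rfl
      obtain ⟨a, b, ha, hb, hab⟩ := h2 j k hjk
      have hupd := hx (Function.update (Function.update v j a) k b) j ⟨i, rfl⟩
      refine key (Function.update (Function.update v j a) k b) _ ?_ hupd ?_
      · intro m
        by_cases hm : m = k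
        · subst hm
          rwa [Function.update_self]
        · rw [Function.update_of_ne hm]
          by_cases hm' : m = j
          · subst hm'
            rwa [Function.update_self]
          · rw [Function.update_of_ne hm']
            exact hvY m
      · rw [testVec, Function.update_self, Function.update_of_ne hjk, Function.update_self]
        exact smul_ne_zero hab (single_zero_one_ne_zero _)
    · push Not at hxx
      obtain ⟨w, hw⟩ := exists_dotProduct_ne_zero hdet (hv k)
      exact key v w hvY (hx' hxx w) (smul_ne_zero hw (single_zero_one_ne_zero _))

/-- As paths are unique, the block of the action from `x` to `y` is one coefficient times one path
map. Each path thus either lies in the ideal or has coefficient zero. -/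
theorem isFaithful_familySRep (hdet : IsUnit J.det)
    (h1 : ∀ j, ∃ v, v ≠ 0 ∧ vecMulVec v (Pi.single 0 1) ∈ Y j)
    (h2 : ∀ j k, j ≠ k → ∃ v w, vecMulVec v (Pi.single 0 1) ∈ Y j ∧
      vecMulVec w (Pi.single 0 1) ∈ Y k ∧ w ⬝ᵥ Jᵀ *ᵥ v ≠ 0) :
    IsFaithful (flagRel K r n) (familySRep J i₀ h₀ Y) := by
  classical
  intro f hf
  have hsum : f = (PathAlgebra.toFinsupp K _ f).sum fun p c => c • PathAlgebra.ofPath K p.2.2 := by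
    apply (PathAlgebra.toFinsupp K _).injective
    rw [map_finsuppSum]
    conv_lhs => rw [← Finsupp.sum_single (PathAlgebra.toFinsupp K _ f)]
    refine Finsupp.sum_congr fun p _ => ?_
    rw [map_smul, PathAlgebra.ofPath, LinearEquiv.apply_symm_apply, Finsupp.smul_single_one]
  rw [hsum]
  refine sum_mem fun p hp => ?_
  rcases p with ⟨x, y, p⟩
  by_cases hxy : ∃ j i l, x = .x j i ∧ y = .x' j l
  · obtain ⟨j, i, l, hx, hy⟩ := hxy
    have := TwoSidedIdeal.mul_mem_left (flagRel K r n)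
      (PathAlgebra.toFinsupp K _ f ⟨x, y, p⟩ • 1) _ (ofPath_mem_flagRel K p hx hy)
    rwa [PathAlgebra.smul_mul', PathAlgebra.one_mul] at this
  · push Not at hxy
    obtain ⟨R, hR, hRp⟩ := exists_pathMap_ne_zero hdet h1 h2 p hxy
    refine absurd ?_ (Finsupp.mem_support_iff.1 hp)
    by_contra hc
    refine hRp (Matrix.ext_of_mulVec_single fun k => ?_)
    have h := Rep.act_single_apply R f p (Pi.single k 1)
    rw [hf R hR, LinearMap.zero_apply, Pi.zero_apply] at h
    rw [zero_mulVec]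
    exact (smul_eq_zero.1 h.symm).resolve_left hc

end Faithful

/-! ## Irreducible components of the flag varieties -/

section Components

open Matrix

/-- Each component is the closure of some `C i`, and faithfulness passes to larger sets. -/
theorem componentsFaithful_of_iUnion {K V ι : Type*} [Field K] [Quiver V] {β : V → ℕ} [Finite ι]
    {I : TwoSidedIdeal (PathAlgebra K V)} {X : Set (Rep K β)} {C : ι → Set (Rep K β)}
    (hC : ∀ i, IsIrreducible (C i)) (hX : X = ⋃ i, C i)
    (hne : ∀ i j, i ≠ j → ¬ C i ⊆ closure (C j)) (hI : ∀ i, IsFaithful I (C i)) :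
    ComponentsFaithful I X := by
  intro Z hZ f hf
  rw [(irreducibleComponents_of_iUnion hC hX hne).1] at hZ
  obtain ⟨i, rfl⟩ := hZ
  refine hI i f fun R hR => hf R ⟨⟨R, hX ▸ Set.mem_iUnion_of_mem i hR⟩, subset_closure hR, rfl⟩

variable {K : Type*} [Field K] {r n δ : ℕ}
  {J : Matrix (Fin (2 * n + δ)) (Fin (2 * n + δ)) K}

theorem vecMulVec_mem_isotropic {ν ι : Type*} [Fintype ν] {J : Matrix ν ν K} {v : ν → K}
    (hv : v ⬝ᵥ J *ᵥ v = 0) (w : ι → K) : vecMulVec v w ∈ isotropic ι J := by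
  change (vecMulVec v w)ᵀ * J * vecMulVec v w = 0
  rw [transpose_vecMulVec, vecMulVec_mul, vecMulVec_mul_vecMulVec, ← dotProduct_mulVec, hv]
  ext
  simp

/-- The case where all isotropic matrices form one family. -/
theorem irreducible_and_faithful [IsAlgClosed K] (hn : 0 < n) {ε : ℤˣ}
    (hJ : Jᵀ = ((ε : ℤ) : K) • J) (hdet : IsUnit J.det)
    (hcurve : ∀ m : ℕ, CurveConnected (isotropic (Fin m) J))
    (hvec : ∃ v w, v ⬝ᵥ J *ᵥ v = 0 ∧ w ⬝ᵥ J *ᵥ w = 0 ∧ w ⬝ᵥ Jᵀ *ᵥ v ≠ 0) :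
    IsIrreducible (flagSRep r n δ ε J hJ hdet) ∧
      ComponentsFaithful (flagRel K r n) (flagSRep r n δ ε J hJ hdet) := by
  have : Infinite K := IsAlgClosed.instInfinite
  obtain ⟨m, rfl⟩ : ∃ m, n = m + 1 := ⟨n - 1, by omega⟩
  rw [flagSRep_eq_familySRep (i₀ := Fin.last m) (h₀ := rfl)]
  have hirr : IsIrreducible (familySRep (r := r) J (Fin.last m) rfl fun _ => isotropic _ J) :=
    isIrreducible_familySRep (fun _ => hcurve _) fun _ => ⟨0, by simp [isotropic]⟩
  obtain ⟨v, w, hv, hw, hvw⟩ := hvec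
  refine ⟨hirr, componentsFaithful_of_iUnion (ι := Unit) (fun _ => hirr)
    (Set.iUnion_const _).symm (fun i j hij => absurd rfl hij) fun _ => isFaithful_familySRep hdet (fun _ => ⟨v, ?_, ?_⟩)
      fun _ _ _ => ⟨v, w, vecMulVec_mem_isotropic hv _, vecMulVec_mem_isotropic hw _, hvw⟩⟩
  · rintro rfl
    simp at hvw
  · exact vecMulVec_mem_isotropic hv _

theorem exists_isotropic_pair_of_skew (h2 : (2 : K) ≠ 0) (hn : 0 < n) (hJ : Jᵀ = -J)
    (hdet : IsUnit J.det) :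
    ∃ v w, v ⬝ᵥ J *ᵥ v = 0 ∧ w ⬝ᵥ J *ᵥ w = 0 ∧ w ⬝ᵥ Jᵀ *ᵥ v ≠ 0 := by
  have h : ∀ v, v ⬝ᵥ J *ᵥ v = 0 := by
    intro v
    have h1 : v ⬝ᵥ J *ᵥ v = -(v ⬝ᵥ J *ᵥ v) := by
      conv_lhs => rw [dotProduct_mulVec, dotProduct_comm, ← mulVec_transpose, hJ, neg_mulVec,
        dotProduct_neg]
    exact (mul_eq_zero.1 (by linear_combination h1 : 2 * (v ⬝ᵥ J *ᵥ v) = 0)).resolve_left h2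
  have h0 : 0 < 2 * n + δ := by omega
  obtain ⟨v, hv⟩ := exists_dotProduct_ne_zero hdet
    (v := Pi.single ⟨0, h0⟩ 1) (Pi.single_ne_zero_iff.2 one_ne_zero)
  exact ⟨v, _, h _, h _, hv⟩

theorem exists_isotropic_pair_of_symm [IsAlgClosed K] (h2 : (2 : K) ≠ 0) (hn : 0 < n)
    (hJ : Jᵀ = J) (hdet : IsUnit J.det) :
    ∃ v w, v ⬝ᵥ J *ᵥ v = 0 ∧ w ⬝ᵥ J *ᵥ w = 0 ∧ w ⬝ᵥ Jᵀ *ᵥ v ≠ 0 := by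
  have hs := toBilin'_isSymm hJ
  obtain ⟨w, -, hw0, hw⟩ := exists_isotropic_notMem h2 (toBilin'_nondegenerate hdet) hs (W := ⊥)
    (by simp; omega)
  obtain ⟨u, hu⟩ := exists_dotProduct_ne_zero hdet (v := w) (by simpa using hw0)
  rw [hJ, ← Matrix.toBilin'_apply'] at hu
  have hww : J.toBilin' w w = 0 := hw
  have h3 : J.toBilin' u w = J.toBilin' w u := hs.eq u w
  -- The multiple of the isotropic vector `w` cancels the norm of `u` and leaves its pairing with
  -- `w` unchanged.
  refine ⟨u - (J.toBilin' u u / (2 * J.toBilin' w u)) • w, w, ?_, ?_, ?_⟩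
  · rw [← Matrix.toBilin'_apply']
    simp only [map_sub, LinearMap.sub_apply, map_smul, LinearMap.smul_apply, smul_eq_mul, hww, h3]
    field_simp
    ring
  · rwa [← Matrix.toBilin'_apply']
  · rw [hJ, ← Matrix.toBilin'_apply', map_sub, map_smul, hww, smul_zero, sub_zero]
    exact hu

theorem IsFrame.dotProduct {ν ι : Type*} [Fintype ν] [DecidableEq ν] [Fintype ι] [DecidableEq ι]
    {J : Matrix ν ν K} {H : Matrix ν (ι ⊕ ι) K} (hH : IsFrame J H) (a b : ι ⊕ ι) :
    H.col a ⬝ᵥ J *ᵥ H.col b = hyp K ι a b := by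
  rw [← Matrix.toBilin'_apply', ← transpose_mul_mul_apply, hH]

/-- The sign attached to a family. -/
def boolSign (K : Type*) [Field K] (b : Bool) : K := if b then -1 else 1

theorem boolSign_eq_neg {b b' : Bool} (h : b ≠ b') : boolSign K b' = -boolSign K b := by
  cases b <;> cases b' <;> simp_all [boolSign]

/-- The even orthogonal case. -/
theorem ncard_components_and_faithful [IsAlgClosed K] (h2 : (2 : K) ≠ 0) (hn : 0 < n)
    {J : Matrix (Fin (2 * n + 0)) (Fin (2 * n + 0)) K} {ε : ℤˣ}
    (hJ : Jᵀ = ((ε : ℤ) : K) • J) (hJ' : Jᵀ = J) (hdet : IsUnit J.det) :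
    (irreducibleComponents (flagSRep r n 0 ε J hJ hdet)).ncard = 2 ^ r ∧
      (2 ≤ n ∨ r = 1 →
        ComponentsFaithful (flagRel K r n) (flagSRep r n 0 ε J hJ hdet)) := by
  have : Infinite K := IsAlgClosed.instInfinite
  obtain ⟨m, rfl⟩ : ∃ m, n = m + 1 := ⟨n - 1, by omega⟩
  have hcard : Fintype.card (Fin (2 * (m + 1) + 0)) = 2 * Fintype.card (Fin (m + 1)) := by simp
  -- Factoring the zero matrix serves only to produce a reference hyperbolic frame.
  obtain ⟨E, F, -, e1, e2, e3, e4, -⟩ := exists_hyperbolic_factorization h2 hJ' hdet hcard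
    (A := 0) (by simp [isotropic])
  obtain ⟨H, hH⟩ : ∃ H : Matrix (Fin (2 * (m + 1) + 0)) (Fin (m + 1) ⊕ Fin (m + 1)) K,
    IsFrame J H := ⟨_, isFrame_fromCols e1 e2 e3 e4⟩
  rw [flagSRep_eq_familySRep (i₀ := Fin.last m) (h₀ := rfl)]
  have hmem : ∀ (s : Finset (Fin (m + 1))) (b : Bool) (i : Fin (m + 1)),
      (-1 : K) ^ s.card = boolSign K b →
      vecMulVec (H.col (if i ∈ s then Sum.inr i else Sum.inl i)) (Pi.single 0 1) ∈
        isotropicClass H (boolSign K b) := fun s b i h => by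
    rw [← h]
    exact vecMulVec_mem_isotropicClass H s i 0
  have hvec : ∀ b, ∃ v, v ≠ 0 ∧ vecMulVec v (Pi.single (0 : Fin (m + 1)) 1) ∈
      isotropicClass H (boolSign K b) := by
    have h0 : ∀ a b, hyp K (Fin (m + 1)) a b ≠ 0 → H.col a ≠ 0 := by
      intro a b hab h
      rw [← hH.dotProduct, h, zero_dotProduct] at hab
      exact hab rfl
    rintro (_ | _)
    · exact ⟨_, h0 (Sum.inl 0) (Sum.inr 0) (by simp [hyp]), by
        simpa using hmem ∅ false 0 (by simp [boolSign])⟩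
    · exact ⟨_, h0 (Sum.inr 0) (Sum.inl 0) (by simp [hyp]), by
        simpa using hmem {0} true 0 (by simp [boolSign])⟩
  have hne : ∀ b, (isotropicClass H (boolSign K b)).Nonempty := fun b =>
    let ⟨_, _, h⟩ := hvec b
    ⟨_, h⟩
  let C : (Fin r → Bool) → Set (Rep K (flagDim r (m + 1) 0)) := fun c =>
    familySRep J (Fin.last m) rfl fun j => isotropicClass H (boolSign K (c j))
  have hC : ∀ c, IsIrreducible (C c) := fun c =>
    isIrreducible_familySRep (fun j => curveConnected_isotropicClass h2 H _) fun j => hne _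
  have hX : (familySRep (r := r) J (Fin.last m) rfl fun _ => isotropic _ J) = ⋃ c, C c := by
    ext R
    simp only [Set.mem_iUnion]
    constructor
    · rintro ⟨h, hR⟩
      have : ∀ j, ∃ b, R.last j (Fin.last m) rfl ∈ isotropicClass H (boolSign K b) := by
        intro j
        rcases isotropic_subset_union h2 hJ' hdet hcard hH (hR j) with h | h
        · exact ⟨false, by simpa [boolSign] using h⟩
        · exact ⟨true, by simpa [boolSign] using h⟩
      choose c hc using this
      exact ⟨c, h, hc⟩
    · rintro ⟨c, h, hR⟩
      exact ⟨h, fun j => isotropicClass_subset hH _ (hR j)⟩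
  have hnest : ∀ c c', c ≠ c' → ¬ C c ⊆ closure (C c') := by
    intro c c' hcc
    obtain ⟨j, hj⟩ := Function.ne_iff.1 hcc
    obtain ⟨g, hg, hgdet⟩ : ∃ g ∈ splitO K (Fin (m + 1)), g.det = boolSign K (c j) := by
      obtain ⟨_, g, hg, -, h, -⟩ := hne (c j)
      exact ⟨g, hg, h⟩
    obtain ⟨N, hN, hN'⟩ := exists_separating_det h2 hH hg (ε := boolSign K (c' j))
      (by rw [hgdet, boolSign_eq_neg hj])
    rw [hgdet] at hN'
    exact not_familySRep_subset_closure (fun j => hne _) j N hN hN'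
  refine ⟨?_, fun hnr => componentsFaithful_of_iUnion hC hX hnest fun c =>
    isFaithful_familySRep hdet (fun j => hvec _) fun j k hjk => ?_⟩
  · obtain ⟨h1, h3⟩ := irreducibleComponents_of_iUnion hC hX hnest
    rw [h1, ← Set.image_univ, Set.ncard_image_of_injective _ h3, Set.ncard_univ]
    simp
  · rcases hnr with hm | rfl
    · have h01 : (0 : Fin (m + 1)) ≠ Fin.last m := fun h => by
        have := congrArg Fin.val h
        simp at this
        omega
      -- These two frame vectors pair to `1`, and each occurs in both families: including or
      -- omitting the second index `Fin.last m` in the swapped set adjusts the parity without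
      -- affecting index `0`.
      refine ⟨H.col (Sum.inl 0), H.col (Sum.inr 0), ?_, ?_, ?_⟩
      · cases c j
        · simpa using hmem ∅ false 0 (by simp [boolSign])
        · simpa [h01] using hmem {Fin.last m} true 0 (by simp [boolSign])
      · cases c k
        · simpa using hmem {0, Fin.last m} false 0 (by simp [boolSign, h01])
        · simpa using hmem {0} true 0 (by simp [boolSign])
      · rw [hJ', hH.dotProduct]
        simp [hyp]
    · exact absurd (Subsingleton.elim j k) hjk

end Components

end FlagQuiver

theorem proposition4 {K : Type*} [Field K] [IsAlgClosed K] (hchar : ringChar K ≠ 2)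
    (r n : ℕ) (hr : 0 < r) (hn : 0 < n) :
    -- odd orthogonal case
    (∀ (J : Matrix (Fin (2 * n + 1)) (Fin (2 * n + 1)) K)
        (hJ : J.transpose = (((1 : ℤˣ) : ℤ) : K) • J) (hdet : IsUnit J.det),
      IsIrreducible (FlagQuiver.flagSRep r n 1 1 J hJ hdet) ∧
      FlagQuiver.ComponentsFaithful (FlagQuiver.flagRel K r n)
        (FlagQuiver.flagSRep r n 1 1 J hJ hdet)) ∧
    -- symplectic case
    (∀ (J : Matrix (Fin (2 * n + 0)) (Fin (2 * n + 0)) K)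
        (hJ : J.transpose = (((-1 : ℤˣ) : ℤ) : K) • J) (hdet : IsUnit J.det),
      IsIrreducible (FlagQuiver.flagSRep r n 0 (-1) J hJ hdet) ∧
      FlagQuiver.ComponentsFaithful (FlagQuiver.flagRel K r n)
        (FlagQuiver.flagSRep r n 0 (-1) J hJ hdet)) ∧
    -- even orthogonal case
    (∀ (J : Matrix (Fin (2 * n + 0)) (Fin (2 * n + 0)) K)
        (hJ : J.transpose = (((1 : ℤˣ) : ℤ) : K) • J) (hdet : IsUnit J.det),
      (irreducibleComponents (FlagQuiver.flagSRep r n 0 1 J hJ hdet)).ncard = 2 ^ r ∧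
      (2 ≤ n ∨ r = 1 → FlagQuiver.ComponentsFaithful (FlagQuiver.flagRel K r n)
        (FlagQuiver.flagSRep r n 0 1 J hJ hdet))) := by
  have h2 : (2 : K) ≠ 0 := Ring.two_ne_zero hchar
  refine ⟨fun J hJ hdet => ?_, fun J hJ hdet => ?_, fun J hJ hdet => ?_⟩
  · have hJ' : J.transpose = J := by simpa using hJ
    exact FlagQuiver.irreducible_and_faithful hn hJ hdet
      (fun m => FlagQuiver.curveConnected_isotropic_of_odd h2 hJ' hdet (by simp))
      (FlagQuiver.exists_isotropic_pair_of_symm h2 hn hJ' hdet)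
  · have hJ' : J.transpose = -J := by simpa using hJ
    exact FlagQuiver.irreducible_and_faithful hn hJ hdet
      (fun m => FlagQuiver.curveConnected_isotropic_of_skew hJ')
      (FlagQuiver.exists_isotropic_pair_of_skew h2 hn hJ' hdet)
  · exact FlagQuiver.ncard_components_and_faithful h2 hn hJ (by simpa using hJ) hdet
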